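/- Let $\Theta=\Theta_1\times\cdots\times\Theta_n$ be a finite set of states $\theta=(\theta_1,\dots,\theta_n)$, and consider the variables $\theta_1,\dots,\theta_n$, a real-valued price $\phi$ and a real-valued add-on $q$. A subjective causal model is a directed acyclic graph $G=(N,R)$ whose nodes are $\phi$, $q$ and some of the variables $\theta_i$, without links of the form $\phi\to\theta_i$ or $q\to\theta_i$; $R(k)$ denotes the set of parents of the node $k$. It is perfect if any two distinct parents of a node are linked to each other. Given a probability distribution $p$ over $(\theta,\phi,q)$, let $p_G(x_N)=\prod_{k\in N}p(x_k\mid x_{R(k)})$ (for continuous variables, this is read in terms of densities), and let $p_G(q\mid\phi)$ be the conditional distribution derived from it. The distribution $p$ is fully revealing if both families of conditional distributions $p(\phi\mid\theta)$ and $p(\theta\mid\phi)$ are degenerate; $\theta^p(\phi)$ then denotes the state $\theta$ with $p(\theta\mid\phi)=1$. Fix a probability distribution $\mu$ on $\Theta$, with support $\Theta_\mu$ (so $\Theta_\mu=\Theta$ if $\mu$ has full support), and a perfect subjective causal model $G$. Then there is a unique transition matrix $\beta=(\beta(\theta'\mid\theta))_{\theta,\theta'\in\Theta_\mu}$ (nonnegative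 entries, $\sum_{\theta'}\beta(\theta'\mid\theta)=1$ for every $\theta$) with the following property: for every fully revealing distribution $p$ over $(\theta,\phi,q)$ whose marginal over $\theta$ is $\mu$, and for every price $\phi$ in the support of $p$, $$p_G(q\mid\phi)=\sum_{\theta'\in\Theta_\mu}\beta(\theta'\mid\theta^p(\phi))\,p(q\mid\theta')$$ (an identity between distributions of $q$). Moreover, $\mu$ is an invariant distribution of $\beta$: $\sum_{\theta}\mu(\theta)\beta(\theta'\mid\theta)=\mu(\theta')$ for every $\theta'\in\Theta_\mu$. -/

import Mathlib

open MeasureTheory ProbabilityTheory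
open scoped ENNReal

/-! ### Variables and outcomes -/

/-- The variables: the state variables `θ₁, …, θₙ`, the price `φ` and the add-on `q`. -/
inductive Node (n : ℕ) where
  | state (i : Fin n) : Node n
  | price : Node n
  | addOn : Node n
  deriving DecidableEq

/-- The set of states `Θ₁ × ⋯ × Θₙ`. -/
abbrev States {n : ℕ} (Θ : Fin n → Type) : Type := (i : Fin n) → Θ i

/-- The triples `(θ, φ, q)`: a state, a price and an add-on. -/
abbrev Outcome {n : ℕ} (Θ : Fin n → Type) : Type := States Θ × ℝ × ℝ

/-- The set of values of a variable. -/
def Val {n : ℕ} (Θ : Fin n → Type) : Node n → Type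
  | .state i => Θ i
  | .price => ℝ
  | .addOn => ℝ

instance Val.measurableSpace {n : ℕ} (Θ : Fin n → Type) [∀ i, MeasurableSpace (Θ i)] :
    (v : Node n) → MeasurableSpace (Val Θ v)
  | .state i => inferInstanceAs (MeasurableSpace (Θ i))
  | .price => inferInstanceAs (MeasurableSpace ℝ)
  | .addOn => inferInstanceAs (MeasurableSpace ℝ)

/-- The value of a variable at an outcome `(θ, φ, q)`. -/
def coord {n : ℕ} {Θ : Fin n → Type} : (v : Node n) → Outcome Θ → Val Θ v
  | .state i, ω => ω.1 i
  | .price, ω => ω.2.1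
  | .addOn, ω => ω.2.2

/-! ### The Bayesian-network factorization

Densities are taken relative to the product of the marginal laws of the variables, so that
variables with a continuous distribution are covered along with discrete ones. A joint law has
such densities whenever all variables but one are discrete; this is the case for the
fully revealing distributions below. For discrete variables `bayesNet` gives to every point the
mass `∏ i, p (x i | x (R i))`. -/

/-- The joint density `p (x_A)` of the variables in `A`, relative to the product of the
marginals of `p`. -/
noncomputable def jointDensity {Ω I : Type} [MeasurableSpace Ω] {E : I → Type}
    [∀ i, MeasurableSpace (E i)] (p : Measure Ω) (X : (i : I) → Ω → E i) (A : Finset I)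
    (x : (i : I) → E i) : ℝ≥0∞ :=
  (p.map fun ω (i : A) => X i ω).rnDeriv (Measure.pi fun i : A => p.map (X i))
    (fun i : A => x i)

/-- The measure `∏ i, p (x i | x (R i))`, where `R i` is the set of parents of `i` and
`p (x i | x (R i)) = p (x i, x (R i)) / p (x (R i))`. -/
noncomputable def bayesNet {Ω I : Type} [MeasurableSpace Ω] [Fintype I] [DecidableEq I]
    {E : I → Type} [∀ i, MeasurableSpace (E i)] (p : Measure Ω) (X : (i : I) → Ω → E i)
    (R : I → Finset I) : Measure ((i : I) → E i) :=
  (Measure.pi fun i => p.map (X i)).withDensity fun x =>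
    ∏ i, jointDensity p X (insert i (R i)) x / jointDensity p X (R i) x

/-! ### Subjective causal models -/

/-- A subjective causal model: a directed acyclic graph whose nodes are the price, the add-on
and some of the state variables, with no link from the price or the add-on into a state
variable. -/
structure CausalModel (n : ℕ) where
  /-- the set of nodes -/
  nodes : Finset (Node n)
  /-- `link i j` means `i → j` -/
  link : nodes → nodes → Prop
  acyclic : ∀ i, ¬ Relation.TransGen link i i
  price_mem : Node.price ∈ nodes
  addOn_mem : Node.addOn ∈ nodes
  state_exogenous : ∀ (i j : nodes) (k : Fin n),
    (i : Node n) = .price ∨ (i : Node n) = .addOn → (j : Node n) = .state k → ¬ link i j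

namespace CausalModel

variable {n : ℕ}

/-- A DAG is perfect if any two distinct parents of a node are linked. -/
def IsPerfect (G : CausalModel n) : Prop :=
  ∀ i j k : G.nodes, i ≠ j → G.link i k → G.link j k → G.link i j ∨ G.link j i

open Classical in
/-- The set of parents of a node. -/
noncomputable def parents (G : CausalModel n) (k : G.nodes) : Finset G.nodes :=
  Finset.univ.filter fun i => G.link i k

/-- The subjective belief `p_G` over the variables of the model. -/
noncomputable def belief (G : CausalModel n) {Θ : Fin n → Type} [∀ i, MeasurableSpace (Θ i)]
    (p : Measure (Outcome Θ)) : Measure ((v : G.nodes) → Val Θ v) :=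
  bayesNet p (fun v : G.nodes => coord (v : Node n)) G.parents

/-- The event `φ = f`, for the variables of the model. -/
def priceEvent (G : CausalModel n) (Θ : Fin n → Type) (f : ℝ) :
    Set ((v : G.nodes) → Val Θ v) :=
  {x | (show ℝ from x ⟨.price, G.price_mem⟩) = f}

/-- The event `q ∈ B`, for the variables of the model. -/
def addOnEvent (G : CausalModel n) (Θ : Fin n → Type) (B : Set ℝ) :
    Set ((v : G.nodes) → Val Θ v) :=
  {x | (show ℝ from x ⟨.addOn, G.addOn_mem⟩) ∈ B}

end CausalModel

/-! ### Fully revealing distributions -/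

section Revealing

variable {n : ℕ} {Θ : Fin n → Type}

/-- The event that the state is `θ`. -/
def stateIs (θ : States Θ) : Set (Outcome Θ) := {ω | ω.1 = θ}

/-- The event that the price is `f`. -/
def priceIs (f : ℝ) : Set (Outcome Θ) := {ω | ω.2.1 = f}

/-- The event that the add-on lies in `B`. -/
def addOnIn (B : Set ℝ) : Set (Outcome Θ) := {ω | ω.2.2 ∈ B}

/-- Both `p (φ | θ)` and `p (θ | φ)` are degenerate. (By the first condition, `φ` takes finitely
many values with probability one if the set of states is finite.) -/
def IsFullyRevealing [∀ i, MeasurableSpace (Θ i)] (p : Measure (Outcome Θ)) : Prop :=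
  (∀ θ : States Θ, p (stateIs θ) ≠ 0 → ∃ f : ℝ, p[|stateIs θ] (priceIs f) = 1) ∧
  (∀ f : ℝ, p (priceIs f) ≠ 0 → ∃ θ : States Θ, p[|priceIs f] (stateIs θ) = 1)

/-! ### Transition matrices -/

noncomputable instance supportFintype [∀ i, Finite (Θ i)] (μ : PMF (States Θ)) :
    Fintype μ.support := Fintype.ofFinite _

/-- A system of conditional probabilities `β (θ' | θ) = β θ θ'`. -/
def IsTransitionMatrix {S : Type} [Fintype S] (β : S → S → ℝ) : Prop :=
  (∀ θ θ', 0 ≤ β θ θ') ∧ ∀ θ, ∑ θ', β θ θ' = 1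

/-- `p_G (q | φ) = ∑ θ', β (θ' | θᵖ(φ)) p (q | θ')` for every fully revealing `p` with
marginal `μ` and every `φ` in its support; `θᵖ(φ)` is the state `θ` with `p (θ | φ) = 1`. -/
def Represents [∀ i, Finite (Θ i)] [∀ i, MeasurableSpace (Θ i)] (μ : PMF (States Θ))
    (G : CausalModel n) (β : μ.support → μ.support → ℝ) : Prop :=
  ∀ p : Measure (Outcome Θ), IsProbabilityMeasure p → p.map Prod.fst = μ.toMeasure →
    IsFullyRevealing p →
    ∀ f : ℝ, p (priceIs f) ≠ 0 →
    ∀ θ : μ.support, p[|priceIs f] (stateIs (θ : States Θ)) = 1 →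
    ∀ B : Set ℝ, MeasurableSet B →
      ((G.belief p)[|G.priceEvent Θ f]).real (G.addOnEvent Θ B) =
        ∑ θ' : μ.support, β θ θ' * (p[|stateIs (θ' : States Θ)]).real (addOnIn B)

/-- `μ` is an invariant distribution of `β`. -/
def IsInvariantDistribution [∀ i, Finite (Θ i)] (μ : PMF (States Θ)) (β : μ.support → μ.support → ℝ) :
    Prop :=
  ∀ θ' : μ.support, ∑ θ : μ.support, (μ θ).toReal * β θ θ' = (μ θ').toReal

end Revealing

/-! Three facts carry the theorem.

Cliques are not distorted: in a perfect DAG, `p_G` and `p` have the same marginal over every clique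
(`lintegral_netDensity_mul`, `belief_of_clique`). The proof removes a childless node `s` by
induction. If `s` lies in the clique, the other members are parents of `s`, and `p(x_s | x_R(s))`
extends the marginal over `R(s)`, itself a clique by perfectness. If it does not, `s` integrates out
to one, except where `p(x_R(s))` is 0 or infinite, and the remaining factors give this set no mass.
In particular the price and the add-on keep their laws.

A representing matrix exists: a price `f` of positive probability is almost surely the same event as
the state `a` it reveals. If `φ` and `q` are linked, their joint law is not distorted and β is the
identity. Otherwise all their parents are state variables. Conditional on its parents, `φ = f` has
probability `p(f)/μ(a_R(φ))` where the parents agree with `a` and zero elsewhere; the factor of `q`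
is a similar sum over states `b` (`belief_inter_of_not_link`). Dividing by `p(f)` gives β(b|a) =
w(a,b) μ(b) / (μ(b_R(q)) μ(a_R(φ))), where w(a,b) is the subjective probability that `R(φ)` is as in
`a` and `R(q)` as in `b`. It depends on `p` only through μ (`parentsWeight_congr`).

One law decides the rest: let price and add-on both equal c(θ) with `c` injective. Then `p_G(q =
c(θ') | φ = c(θ))` is β(θ'|θ), which gives uniqueness; total mass gives the row sums; and summing
over prices gives invariance, because `q` keeps its law. -/

set_option linter.unusedSectionVars false

/-! ### Integration over some of the variables -/

section Marginal

variable {I : Type} [Fintype I] [DecidableEq I] {E : I → Type} [∀ i, MeasurableSpace (E i)]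

theorem dependsOn_lmarginal {ν : ∀ i, Measure (E i)} {f : (∀ i, E i) → ℝ≥0∞} {A D : Finset I}
    (hf : DependsOn f A) : DependsOn (lmarginal ν D f) (A \ D : Finset I) := by
  intro x y h
  unfold lmarginal
  refine lintegral_congr fun z => hf fun i hi => ?_
  by_cases hD : i ∈ D
  · simp [Function.updateFinset, hD]
  · simpa [Function.updateFinset, hD] using h i (by simpa using ⟨hi, hD⟩)

theorem DependsOn.mul {A : Set I} {f g : (∀ i, E i) → ℝ≥0∞} (hf : DependsOn f A)
    (hg : DependsOn g A) : DependsOn (fun x => f x * g x) A := fun _ _ h => by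
  simp only [hf h, hg h]

theorem DependsOn.div {A : Set I} {f g : (∀ i, E i) → ℝ≥0∞} (hf : DependsOn f A)
    (hg : DependsOn g A) : DependsOn (fun x => f x / g x) A := fun _ _ h => by
  simp only [hf h, hg h]

theorem dependsOn_indicator_one {A : Set I} {Z : Set (∀ i, E i)}
    (hZ : ∀ x y, (∀ i ∈ A, x i = y i) → (x ∈ Z → y ∈ Z)) :
    DependsOn (Z.indicator fun _ => (1 : ℝ≥0∞)) A := fun x y h => by
  by_cases hx : x ∈ Z
  · simp [hx, hZ x y h hx]
  · have hy : y ∉ Z := fun hy => hx (hZ y x (fun i hi => (h i hi).symm) hy)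
    simp [hx, hy]

/-- A function that depends only on the variables in `A` factors measurably through them. -/
theorem DependsOn.exists_measurable_comp {A : Finset I} {f : (∀ i, E i) → ℝ≥0∞}
    (hf : DependsOn f A) (hm : Measurable f) (x₀ : ∀ i, E i) :
    ∃ g : ((i : A) → E i) → ℝ≥0∞, Measurable g ∧ ∀ x, f x = g fun i => x i := by
  refine ⟨fun y => f (Function.updateFinset x₀ A y), hm.comp measurable_updateFinset, fun x => ?_⟩
  exact hf fun i hi => by simp [Function.updateFinset, Finset.mem_coe.1 hi]

variable (ν : ∀ i, Measure (E i)) [∀ i, IsProbabilityMeasure (ν i)]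

/-- Fubini, together with the fact that averaging twice over `D` is the same as averaging once, each
factor having mass one. -/
theorem lintegral_pi_lmarginal (D : Finset I) {f : (∀ i, E i) → ℝ≥0∞} (hf : Measurable f) :
    ∫⁻ x, lmarginal ν D f x ∂Measure.pi ν = ∫⁻ x, f x ∂Measure.pi ν := by
  rcases isEmpty_or_nonempty (∀ i, E i) with h | ⟨⟨x⟩⟩
  · simp_rw [lintegral_of_isEmpty]
  rw [lintegral_eq_lmarginal_univ x, lintegral_eq_lmarginal_univ x,
    ← Finset.sdiff_union_of_subset (Finset.subset_univ D),
    lmarginal_union ν f hf Finset.sdiff_disjoint,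
    lmarginal_union ν _ (hf.lmarginal ν) Finset.sdiff_disjoint]
  congr 1
  ext y
  conv_lhs => rw [lmarginal]
  rw [lintegral_congr (g := fun _ => lmarginal ν D f y), lintegral_const, measure_univ, mul_one]
  intro z
  exact lmarginal_congr ν f fun i hi => by simp [Function.updateFinset, hi]

theorem lmarginal_mul_of_dependsOn {D : Finset I} {u v : (∀ i, E i) → ℝ≥0∞} (hv : Measurable v)
    (hu : DependsOn u (Dᶜ : Finset I)) (x : ∀ i, E i) :
    lmarginal ν D (fun x => u x * v x) x = u x * lmarginal ν D v x := by
  unfold lmarginal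
  refine Eq.trans (lintegral_congr fun y => ?_)
    (lintegral_const_mul (u x) (hv.comp measurable_updateFinset))
  beta_reduce
  congr 1
  exact hu fun i hi => by
    have : i ∉ D := by simpa using hi
    simp [Function.updateFinset, this]

/-- The conditional-expectation identity for a product measure: a factor `u` that ignores `D` cannot
tell `v` from its average over `D`. -/
theorem lintegral_mul_lmarginal {D : Finset I} {u v : (∀ i, E i) → ℝ≥0∞} (hmu : Measurable u)
    (hv : Measurable v) (hu : DependsOn u (Dᶜ : Finset I)) :
    ∫⁻ x, u x * lmarginal ν D v x ∂Measure.pi ν = ∫⁻ x, u x * v x ∂Measure.pi ν := by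
  refine Eq.trans (lintegral_congr fun x => ?_) (lintegral_pi_lmarginal ν D (hmu.mul hv))
  exact (lmarginal_mul_of_dependsOn ν hv hu x).symm

theorem lintegral_eq_lmarginal_of_dependsOn {A : Finset I} {f : (∀ i, E i) → ℝ≥0∞}
    (hf : DependsOn f A) (hm : Measurable f) (x : ∀ i, E i) :
    ∫⁻ y, f y ∂Measure.pi ν = lmarginal ν A f x := by
  rw [← lintegral_pi_lmarginal ν A hm, lintegral_congr (g := fun _ => lmarginal ν A f x),
    lintegral_const, measure_univ, mul_one]
  exact fun y => dependsOn_lmarginal hf fun i hi => by simp at hi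

end Marginal

/-! ### Joint densities -/

section Density

variable {Ω I : Type} [MeasurableSpace Ω] [Fintype I] [DecidableEq I] {E : I → Type}
  [∀ i, MeasurableSpace (E i)] (p : Measure Ω) (X : (i : I) → Ω → E i)

/-- The product of the marginal laws of the variables. -/
noncomputable abbrev productLaw : Measure ((i : I) → E i) := Measure.pi fun i => p.map (X i)

theorem measurable_jointDensity (A : Finset I) : Measurable (jointDensity p X A) :=
  (Measure.measurable_rnDeriv _ _).comp (measurable_pi_lambda _ fun _ => measurable_pi_apply _)

theorem dependsOn_jointDensity (A : Finset I) : DependsOn (jointDensity p X A) A := by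
  intro x y h
  unfold jointDensity
  congr 1
  ext i
  exact h i i.2

variable {p X} [IsProbabilityMeasure p] (hX : ∀ i, Measurable (X i))
  (hac : p.map (fun ω i => X i ω) ≪ productLaw p X)
include hX

theorem isProbabilityMeasure_marginal (i : I) : IsProbabilityMeasure (p.map (X i)) :=
  Measure.isProbabilityMeasure_map (hX i).aemeasurable

theorem productLaw_map_restrict (A : Finset I) :
    (productLaw p X).map (fun x (i : A) => x i) = Measure.pi fun i : A => p.map (X i) := by
  have := isProbabilityMeasure_marginal (p := p) hX
  rw [productLaw, ← Measure.infinitePi_eq_pi]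
  exact Measure.infinitePi_map_restrict (fun i => p.map (X i)) (I := A)

include hac

/-- Absolute continuity survives projection to `A`, and the product law projects to the product over
`A`; so this is the Radon-Nikodym property downstairs. It replaces densities by expectations under
`p`. -/
theorem lintegral_jointDensity_mul {A : Finset I} {h : (∀ i, E i) → ℝ≥0∞} (hm : Measurable h)
    (hA : DependsOn h A) :
    ∫⁻ x, jointDensity p X A x * h x ∂productLaw p X = ∫⁻ ω, h (fun i => X i ω) ∂p := by
  have := isProbabilityMeasure_marginal (p := p) hX
  obtain ⟨ω₀⟩ : Nonempty Ω := p.nonempty_of_neZero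
  obtain ⟨g, hg, hgh⟩ := hA.exists_measurable_comp hm fun i => X i ω₀
  have hr : Measurable fun (x : ∀ i, E i) (i : A) => x i :=
    measurable_pi_lambda _ fun i => measurable_pi_apply _
  have hXm : Measurable fun ω i => X i ω := measurable_pi_lambda _ hX
  have hXA : Measurable fun ω (i : A) => X i ω := measurable_pi_lambda _ fun i => hX i
  have : IsProbabilityMeasure (p.map fun ω (i : A) => X i ω) :=
    Measure.isProbabilityMeasure_map hXA.aemeasurable
  have hacA : p.map (fun ω (i : A) => X i ω) ≪ Measure.pi fun i : A => p.map (X i) := by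
    have := hac.map hr
    rwa [productLaw_map_restrict hX, Measure.map_map hr hXm] at this
  simp_rw [hgh]
  have h1 : ∫⁻ x, jointDensity p X A x * g (fun i => x i) ∂productLaw p X =
      ∫⁻ y, (p.map fun ω (i : A) => X i ω).rnDeriv (Measure.pi fun i : A => p.map (X i)) y * g y
        ∂(productLaw p X).map (fun x (i : A) => x i) := by
    exact (lintegral_map ((Measure.measurable_rnDeriv _ _).mul hg) hr).symm
  rw [h1, productLaw_map_restrict hX, lintegral_rnDeriv_mul hacA hg.aemeasurable,
    lintegral_map hg hXA]

/-- The densities of the variables in `A` are positive and finite almost surely. -/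
theorem ae_jointDensity_ne (A : Finset I) :
    ∀ᵐ ω ∂p, jointDensity p X A (fun i => X i ω) ≠ 0 ∧ jointDensity p X A (fun i => X i ω) ≠ ∞ := by
  have := isProbabilityMeasure_marginal (p := p) hX
  have hXm : Measurable fun ω i => X i ω := measurable_pi_lambda _ hX
  have hF := measurable_jointDensity p X A
  set Z : Set (∀ i, E i) := {x | ¬ (jointDensity p X A x ≠ 0 ∧ jointDensity p X A x ≠ ∞)} with hZ
  have hZm : MeasurableSet Z :=
    (((hF (measurableSet_singleton 0)).compl).inter ((hF (measurableSet_singleton ∞)).compl)).compl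
  have hdep : DependsOn (Z.indicator fun _ => (1 : ℝ≥0∞)) A := by
    intro x y h
    have := dependsOn_jointDensity p X A h
    simp only [Set.indicator, hZ, Set.mem_ofPred_eq, this]
  have key := lintegral_jointDensity_mul hX hac (measurable_const.indicator hZm) hdep
  have hfin : ∫⁻ x, jointDensity p X A x ∂productLaw p X ≠ ∞ := by
    have := lintegral_jointDensity_mul hX hac (A := A) (h := fun _ => 1) measurable_const
      (fun _ _ _ => rfl)
    simp only [mul_one] at this
    rw [this]
    simp
  -- The density is integrable, hence almost everywhere finite; on `Z` this leaves only the value 0.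
  have h0 : ∫⁻ x, jointDensity p X A x * Z.indicator (fun _ => (1 : ℝ≥0∞)) x ∂productLaw p X = 0 := by
    refine (lintegral_eq_zero_iff (hF.mul (measurable_const.indicator hZm))).2 ?_
    filter_upwards [ae_lt_top hF hfin] with x hx
    by_cases hxZ : x ∈ Z
    · have : jointDensity p X A x = 0 := by
        by_contra h
        exact hxZ ⟨h, hx.ne⟩
      simp [this]
    · simp [hxZ]
  rw [h0] at key
  have h2 : ∫⁻ ω, Z.indicator (fun _ => (1 : ℝ≥0∞)) (fun i => X i ω) ∂p
      = p ((fun ω i => X i ω) ⁻¹' Z) := by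
    rw [← lintegral_indicator_one (hXm hZm)]
    rfl
  rw [h2] at key
  exact key.symm

end Density

/-! ### Conditional densities and perfect graphs -/

section Network

variable {Ω I : Type} [MeasurableSpace Ω] [Fintype I] [DecidableEq I] {E : I → Type}
  [∀ i, MeasurableSpace (E i)] (p : Measure Ω) (X : (i : I) → Ω → E i) (R : I → Finset I)

/-- The conditional density `p (x i | x (R i))`. -/
noncomputable def condDensity (i : I) (x : ∀ i, E i) : ℝ≥0∞ :=
  jointDensity p X (insert i (R i)) x / jointDensity p X (R i) x

theorem measurable_condDensity (i : I) : Measurable (condDensity p X R i) :=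
  (measurable_jointDensity _ _ _).div (measurable_jointDensity _ _ _)

theorem dependsOn_condDensity (i : I) : DependsOn (condDensity p X R i) (insert i (R i) : Finset I) :=
  (dependsOn_jointDensity _ _ _).div
    ((dependsOn_jointDensity _ _ _).mono (by simp))

/-- The product of the conditional densities of the variables in `S`. -/
noncomputable def netDensity (S : Finset I) (x : ∀ i, E i) : ℝ≥0∞ := ∏ i ∈ S, condDensity p X R i x

theorem measurable_netDensity (S : Finset I) : Measurable (netDensity p X R S) :=
  Finset.measurable_prod _ fun i _ => measurable_condDensity p X R i

theorem dependsOn_netDensity {S : Finset I} (hS : ∀ i ∈ S, R i ⊆ S) :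
    DependsOn (netDensity p X R S) S := by
  intro x y h
  unfold netDensity
  refine Finset.prod_congr rfl fun i hi => dependsOn_condDensity p X R i fun j hj => h j ?_
  rcases Finset.mem_insert.1 (Finset.mem_coe.1 hj) with rfl | hj
  · exact hi
  · exact hS i hi hj

theorem netDensity_insert {S : Finset I} {s : I} (hs : s ∉ S) (x : ∀ i, E i) :
    netDensity p X R (insert s S) x = condDensity p X R s x * netDensity p X R S x := by
  simp [netDensity, Finset.prod_insert hs]

variable {p X} [IsProbabilityMeasure p] (hX : ∀ i, Measurable (X i))
  (hac : p.map (fun ω i => X i ω) ≪ productLaw p X)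
include hX hac

/-- Weighting by a conditional density a function of the conditioning variables and of the
conditioned one. -/
theorem lintegral_jointDensity_mul_condDensity_mul {s : I} {v : (∀ i, E i) → ℝ≥0∞}
    (hv : Measurable v) (hvd : DependsOn v (insert s (R s) : Finset I)) :
    ∫⁻ x, jointDensity p X (R s) x * (condDensity p X R s x * v x) ∂productLaw p X =
      ∫⁻ ω, v (fun i => X i ω) ∂p := by
  have hF := measurable_jointDensity p X (R s)
  have hFd := (dependsOn_jointDensity p X (R s)).mono
    (Finset.coe_subset.2 (Finset.subset_insert s (R s)))
  -- The parents' density is divided by itself instead of being cancelled: the quotient is one only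
  -- `p`-almost surely.
  have h := lintegral_jointDensity_mul hX hac (A := insert s (R s))
    (h := fun x => jointDensity p X (R s) x / jointDensity p X (R s) x * v x)
    ((hF.div hF).mul hv) ((hFd.div hFd).mul hvd)
  calc _ = _ := lintegral_congr fun x => by
          simp only [condDensity, div_eq_mul_inv]; ring
    _ = _ := h
    _ = _ := lintegral_congr_ae <| by
          filter_upwards [ae_jointDensity_ne hX hac (R s)] with ω hω
          simp only [ENNReal.div_self hω.1 hω.2, one_mul]

/-- Weighting by a conditional density, after averaging out the other variables. -/
theorem lintegral_mul_condDensity_mul {s : I} {u v : (∀ i, E i) → ℝ≥0∞}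
    (hu : Measurable u) (hv : Measurable v) (hud : DependsOn u ({s}ᶜ : Finset I))
    (hvd : DependsOn v (insert s (R s) : Finset I)) :
    ∫⁻ x, u x * (condDensity p X R s x * v x) ∂productLaw p X =
      ∫⁻ ω, lmarginal (fun i => p.map (X i)) (insert s (R s))ᶜ u (fun i => X i ω) /
        jointDensity p X (R s) (fun i => X i ω) * v (fun i => X i ω) ∂p := by
  have := isProbabilityMeasure_marginal (p := p) hX
  set ub := lmarginal (fun i => p.map (X i)) (insert s (R s))ᶜ u with hub
  have hubd : DependsOn ub (insert s (R s) : Finset I) :=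
    (dependsOn_lmarginal hud).mono (by intro i; simp; tauto)
  have hubm : Measurable ub := hu.lmarginal _
  have hkv : Measurable fun x => condDensity p X R s x * v x := (measurable_condDensity p X R s).mul hv
  have hFd := (dependsOn_jointDensity p X (R s)).mono
    (Finset.coe_subset.2 (Finset.subset_insert s (R s)))
  have h := lintegral_mul_lmarginal (fun i => p.map (X i)) (D := (insert s (R s))ᶜ) hkv hu
    (by rw [compl_compl]; exact (dependsOn_condDensity p X R s).mul hvd)
  rw [← lintegral_jointDensity_mul hX hac (A := insert s (R s))
    (h := fun x => ub x / jointDensity p X (R s) x * v x)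
    ((hubm.div (measurable_jointDensity _ _ _)).mul hv) ((hubd.div hFd).mul hvd)]
  calc _ = _ := lintegral_congr fun x => mul_comm _ _
    _ = _ := h.symm
    _ = _ := lintegral_congr fun x => by
      rw [← hub]; simp only [condDensity, div_eq_mul_inv]; ring

end Network

/-! ### Clique marginals of a perfect network, and factors with discrete parents -/

section Perfect

variable {Ω I : Type} [MeasurableSpace Ω] [Fintype I] [DecidableEq I] {E : I → Type}
  [∀ i, MeasurableSpace (E i)] {p : Measure Ω} {X : (i : I) → Ω → E i} {R : I → Finset I}
  [IsProbabilityMeasure p]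

/-- A nonempty set of nodes of a directed acyclic graph has a node without children in it. -/
theorem exists_sink {L : I → I → Prop} (hL : ∀ i, ¬ Relation.TransGen L i i) {S : Finset I}
    (hS : S.Nonempty) : ∃ s ∈ S, ∀ i ∈ S, ¬ L s i := by
  have : Std.Irrefl (Function.swap (Relation.TransGen L)) := ⟨hL⟩
  have : IsTrans I (Function.swap (Relation.TransGen L)) := ⟨fun _ _ _ h1 h2 => h2.trans h1⟩
  have hwf := Finite.wellFounded_of_trans_of_irrefl (Function.swap (Relation.TransGen L))
  obtain ⟨s, hs, h⟩ := hwf.has_min (S : Set I) hS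
  exact ⟨s, hs, fun i hi hsi => h i hi (.single hsi)⟩

/-- In a perfect graph, the factorization has the same marginals over cliques as `p`. -/
theorem lintegral_netDensity_mul (hX : ∀ i, Measurable (X i))
    (hac : p.map (fun ω i => X i ω) ≪ productLaw p X)
    (hacyc : ∀ i, ¬ Relation.TransGen (fun i j => i ∈ R j) i i)
    (hperf : ∀ i j k, i ≠ j → i ∈ R k → j ∈ R k → i ∈ R j ∨ j ∈ R i)
    {S : Finset I} (hS : ∀ i ∈ S, R i ⊆ S) {C : Finset I} (hCS : C ⊆ S)
    (hC : ∀ i ∈ C, ∀ j ∈ C, i ≠ j → i ∈ R j ∨ j ∈ R i) {h : (∀ i, E i) → ℝ≥0∞}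
    (hm : Measurable h) (hd : DependsOn h C) :
    ∫⁻ x, netDensity p X R S x * h x ∂productLaw p X = ∫⁻ ω, h (fun i => X i ω) ∂p := by
  have hprob := isProbabilityMeasure_marginal (p := p) hX
  induction hn : S.card generalizing S C h with
  | zero =>
    obtain rfl := Finset.card_eq_zero.1 hn
    obtain rfl := Finset.subset_empty.1 hCS
    obtain ⟨ω₀⟩ : Nonempty Ω := p.nonempty_of_neZero
    obtain ⟨c, hc⟩ : ∃ c, ∀ x, h x = c :=
      ⟨h fun i => X i ω₀, fun x => hd fun i hi => by simp at hi⟩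
    simp [netDensity, hc]
  | succ n ih =>
    obtain ⟨s, hsS, hsink⟩ := exists_sink hacyc (S := S) (Finset.card_pos.1 (by omega))
    have hsR : s ∉ R s := hsink s hsS
    obtain ⟨S', hsS', rfl⟩ : ∃ S', s ∉ S' ∧ S = insert s S' :=
      ⟨S.erase s, Finset.notMem_erase s S, (Finset.insert_erase hsS).symm⟩
    have hS' : ∀ i ∈ S', R i ⊆ S' := fun i hi j hj => by
      refine (Finset.mem_insert.1 (hS i (Finset.mem_insert_of_mem hi) hj)).resolve_left ?_
      rintro rfl
      exact hsink i (Finset.mem_insert_of_mem hi) hj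
    have hRS' : R s ⊆ S' := fun j hj =>
      (Finset.mem_insert.1 (hS s hsS hj)).resolve_left fun h => hsR (h ▸ hj)
    have hn' : S'.card = n := by rw [Finset.card_insert_of_notMem hsS'] at hn; omega
    have hRc : ∀ i ∈ R s, ∀ j ∈ R s, i ≠ j → i ∈ R j ∨ j ∈ R i := fun i hi j hj hij =>
      hperf i j s hij hi hj
    have hW := measurable_netDensity p X R S'
    have hWd := dependsOn_netDensity p X R hS'
    have hF := measurable_jointDensity p X (R s)
    have hFd := dependsOn_jointDensity p X (R s)
    by_cases hsC : s ∈ C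
    -- A sink has no children in `C`, so its neighbours in the clique are all parents.
    · have hCR : C ⊆ insert s (R s) := fun i hi => by
        by_cases his : i = s
        · simp [his]
        · refine Finset.mem_insert_of_mem ((hC i hi s hsC his).resolve_right ?_)
          exact hsink i (hCS hi)
      have hv := (measurable_condDensity p X R s).mul hm
      have hvd : DependsOn (fun x => condDensity p X R s x * h x) (insert s (R s) : Finset I) :=
        (dependsOn_condDensity p X R s).mul (hd.mono (Finset.coe_subset.2 hCR))
      have hlm := hv.lmarginal (s := {s}) (fun i => p.map (X i))
      have hld : DependsOn
          (lmarginal (fun i => p.map (X i)) {s} fun x => condDensity p X R s x * h x) (R s) :=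
        (dependsOn_lmarginal hvd).mono (by intro i; simp; tauto)
      -- Averaging over `s` leaves a function of `R s`, a clique of `S'` by perfectness. The
      -- induction hypothesis applies to it, and the averaging is then undone.
      calc ∫⁻ x, netDensity p X R (insert s S') x * h x ∂productLaw p X
          = ∫⁻ x, netDensity p X R S' x * (condDensity p X R s x * h x) ∂productLaw p X :=
            lintegral_congr fun x => by rw [netDensity_insert p X R hsS']; ring
        _ = ∫⁻ x, netDensity p X R S' x * lmarginal (fun i => p.map (X i)) {s}
              (fun x => condDensity p X R s x * h x) x ∂productLaw p X :=
            (lintegral_mul_lmarginal _ hW hv (hWd.mono (by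
              intro i hi; simp; rintro rfl; exact hsS' hi))).symm
        _ = _ := ih hS' hRS' hRc hlm hld hn'
        _ = ∫⁻ x, jointDensity p X (R s) x * lmarginal (fun i => p.map (X i)) {s}
              (fun x => condDensity p X R s x * h x) x ∂productLaw p X :=
            (lintegral_jointDensity_mul hX hac hlm hld).symm
        _ = ∫⁻ x, jointDensity p X (R s) x * (condDensity p X R s x * h x) ∂productLaw p X :=
            lintegral_mul_lmarginal _ hF hv (hFd.mono (by
              intro i hi; simp; rintro rfl; exact hsR hi))
        _ = _ := lintegral_jointDensity_mul_condDensity_mul R hX hac hm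
            (hd.mono (Finset.coe_subset.2 hCR))
    · have hCS' : C ⊆ S' := fun i hi =>
        (Finset.mem_insert.1 (hCS hi)).resolve_left fun h => hsC (h ▸ hi)
      have hum := hW.mul hm
      have hud : DependsOn (fun x => netDensity p X R S' x * h x) ({s}ᶜ : Finset I) :=
        (hWd.mul (hd.mono (Finset.coe_subset.2 hCS'))).mono (by
          intro i hi; simp; rintro rfl; exact hsS' hi)
      set ub := lmarginal (fun i => p.map (X i)) (insert s (R s))ᶜ
        (fun x => netDensity p X R S' x * h x) with hub
      have hubm : Measurable ub := hum.lmarginal _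
      have hubd : DependsOn ub (R s) := (dependsOn_lmarginal hud).mono (by intro i; simp; tauto)
      have hratio : DependsOn (fun x => jointDensity p X (R s) x / jointDensity p X (R s) x)
          (R s) := hFd.div hFd
      calc ∫⁻ x, netDensity p X R (insert s S') x * h x ∂productLaw p X
          = ∫⁻ x, netDensity p X R S' x * h x * (condDensity p X R s x * 1) ∂productLaw p X :=
            lintegral_congr fun x => by rw [netDensity_insert p X R hsS']; ring
        _ = ∫⁻ ω, ub (fun i => X i ω) / jointDensity p X (R s) (fun i => X i ω) * 1 ∂p :=
            lintegral_mul_condDensity_mul R hX hac hum measurable_const hud fun _ _ _ => rfl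
        _ = ∫⁻ x, jointDensity p X (R s) x * (ub x / jointDensity p X (R s) x) ∂productLaw p X := by
            simp only [mul_one]
            exact (lintegral_jointDensity_mul hX hac (hubm.div hF) (hubd.div hFd)).symm
        _ = ∫⁻ x, jointDensity p X (R s) x / jointDensity p X (R s) x * ub x ∂productLaw p X :=
            lintegral_congr fun x => by simp only [div_eq_mul_inv]; ring
        _ = ∫⁻ x, jointDensity p X (R s) x / jointDensity p X (R s) x *
              (netDensity p X R S' x * h x) ∂productLaw p X :=
            lintegral_mul_lmarginal _ (hF.div hF) hum (hratio.mono (by intro i; simp; tauto))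
        _ = ∫⁻ x, netDensity p X R S' x * h x ∂productLaw p X := by
            -- The quotient equals one off this set. The set concerns only the clique `R s`, so the
            -- induction hypothesis shows that the network on `S'` gives it the same mass as `p`,
            -- namely zero.
            have hZm : Measurable fun x => {y | jointDensity p X (R s) y = 0 ∨
                jointDensity p X (R s) y = ∞}.indicator (fun _ => (1 : ℝ≥0∞)) x :=
              measurable_const.indicator ((hF (measurableSet_singleton 0)).union
                (hF (measurableSet_singleton ∞)))
            have hz := ih hS' hRS' hRc hZm (dependsOn_indicator_one fun x y hxy hx => by
              rwa [Set.mem_ofPred_eq, ← hFd hxy]) hn'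
            have hz0 : ∫⁻ ω, {y | jointDensity p X (R s) y = 0 ∨
                jointDensity p X (R s) y = ∞}.indicator (fun _ => (1 : ℝ≥0∞))
                (fun i => X i ω) ∂p = 0 := by
              rw [lintegral_congr_ae (g := fun _ => 0), lintegral_zero]
              filter_upwards [ae_jointDensity_ne hX hac (R s)] with ω hω
              simp [hω]
            rw [hz0] at hz
            refine lintegral_congr_ae ?_
            filter_upwards [(lintegral_eq_zero_iff (hW.mul hZm)).1 hz] with x hx
            by_cases hxz : jointDensity p X (R s) x = 0 ∨ jointDensity p X (R s) x = ∞
            · have : netDensity p X R S' x = 0 := by simpa [hxz] using hx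
              simp [this]
            · push Not at hxz
              rw [ENNReal.div_self hxz.1 hxz.2, one_mul]
        _ = _ := ih hS' hCS' hC hm hd hn'

variable {τ : Type} [Fintype τ] [MeasurableSpace τ] [MeasurableSingletonClass τ]

/-- Weighting by the conditional density of `X s` when its parents are functions of a discrete
variable `T`. -/
theorem lintegral_mul_condDensity_of_discrete (hX : ∀ i, Measurable (X i))
    (hac : p.map (fun ω i => X i ω) ≪ productLaw p X) {T : Ω → τ} (hT : Measurable T)
    (y : τ → ∀ i, E i) {s : I} (hy : ∀ ω, ∀ i ∈ R s, X i ω = y (T ω) i)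
    (hsing : ∀ t, ∀ i ∈ R s, MeasurableSet {y t i}) {u : (∀ i, E i) → ℝ≥0∞} (hu : Measurable u)
    (hud : DependsOn u ({s}ᶜ : Finset I)) {B : Set (E s)} (hB : MeasurableSet B) :
    ∫⁻ x, u x * (condDensity p X R s x * {x | x s ∈ B}.indicator (fun _ => 1) x) ∂productLaw p X =
      ∑ t, p (T ⁻¹' {t} ∩ X s ⁻¹' B) *
        ((∫⁻ x, u x * {x | ∀ i ∈ R s, x i = y t i}.indicator (fun _ => 1) x ∂productLaw p X) /
          p {ω | ∀ i ∈ R s, X i ω = y t i}) := by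
  have hprob := isProbabilityMeasure_marginal (p := p) hX
  have hF := measurable_jointDensity p X (R s)
  have hFd := dependsOn_jointDensity p X (R s)
  have hBm : Measurable fun x : ∀ i, E i => {x : ∀ i, E i | x s ∈ B}.indicator
      (fun _ => (1 : ℝ≥0∞)) x :=
    measurable_const.indicator (measurable_pi_apply s hB)
  set ub := lmarginal (fun i => p.map (X i)) (insert s (R s))ᶜ u with hub
  have hubm : Measurable ub := hu.lmarginal _
  have hubd : DependsOn ub (R s) := (dependsOn_lmarginal hud).mono (by intro i; simp; tauto)
  rw [lintegral_mul_condDensity_mul R hX hac hu hBm hud (dependsOn_indicator_one fun x z hxz hx => by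
      rwa [Set.mem_ofPred_eq, ← hxz s (by simp)])]
  have hXy : ∀ ω, ub (fun i => X i ω) / jointDensity p X (R s) (fun i => X i ω) =
      ub (y (T ω)) / jointDensity p X (R s) (y (T ω)) := fun ω =>
    (hubd.div hFd) fun i hi => hy ω i hi
  simp only [← hub, hXy]
  -- Split according to the value of `T`, which fixes the parents and so makes the quotient
  -- constant.
  have hsum : ∀ ω, ub (y (T ω)) / jointDensity p X (R s) (y (T ω)) *
      {x : ∀ i, E i | x s ∈ B}.indicator (fun _ => (1 : ℝ≥0∞)) (fun i => X i ω) =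
      ∑ t, ub (y t) / jointDensity p X (R s) (y t) *
        (T ⁻¹' {t} ∩ X s ⁻¹' B).indicator 1 ω := fun ω => by
    classical
    rw [Finset.sum_eq_single (T ω)]
    · simp [Set.indicator]
    · intro t _ ht
      simp [Set.indicator, ht.symm]
    · simp
  have hTB : ∀ t, MeasurableSet (T ⁻¹' {t} ∩ X s ⁻¹' B) := fun t =>
    (hT (measurableSet_singleton t)).inter (hX s hB)
  rw [lintegral_congr hsum, lintegral_finsetSum _ fun t _ =>
    (measurable_one.indicator (hTB t)).const_mul _]
  refine Finset.sum_congr rfl fun t _ => ?_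
  rw [lintegral_const_mul _ (measurable_one.indicator (hTB t)), lintegral_indicator_one (hTB t),
    mul_comm]
  by_cases h0 : p (T ⁻¹' {t} ∩ X s ⁻¹' B) = 0
  · simp [h0]
  congr 1
  set A : Set (∀ i, E i) := {x | ∀ i ∈ R s, x i = y t i} with hA
  have hAm : MeasurableSet A := by
    have : A = ⋂ i ∈ R s, (fun x : ∀ i, E i => x i) ⁻¹' {y t i} := by ext; simp [hA]
    rw [this]
    exact Finset.measurableSet_biInter _ fun i hi => measurable_pi_apply i (hsing t i hi)
  have hAi : Measurable (A.indicator fun _ => (1 : ℝ≥0∞)) := measurable_const.indicator hAm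
  have hAd : DependsOn (A.indicator fun _ => (1 : ℝ≥0∞)) (R s) :=
    dependsOn_indicator_one fun x z hxz hx i hi => by rw [← hxz i hi, hx i hi]
  have hXm : Measurable fun ω i => X i ω := measurable_pi_lambda _ hX
  have hpA : p {ω | ∀ i ∈ R s, X i ω = y t i} ≠ 0 := fun h => h0 <| measure_mono_null (by
    rintro ω ⟨hω, -⟩
    obtain rfl : T ω = t := hω
    exact fun i hi => hy ω i hi) h
  -- The product mass of the cell `A` occurs in both numerator and denominator; it has to be nonzero
  -- to cancel.
  have hνA : productLaw p X A ≠ 0 := fun h => by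
    have := hac h
    rw [Measure.map_apply hXm hAm] at this
    exact hpA this
  have hconst : ∀ f : (∀ i, E i) → ℝ≥0∞, DependsOn f (R s) →
      ∫⁻ x, f x * A.indicator (fun _ => 1) x ∂productLaw p X = f (y t) * productLaw p X A := by
    intro f hf
    rw [lintegral_congr (g := fun x => f (y t) * A.indicator 1 x),
      lintegral_const_mul _ (measurable_one.indicator hAm), lintegral_indicator_one hAm]
    intro x
    by_cases hx : x ∈ A
    · have : f x = f (y t) := hf fun i hi => hx i hi
      simp [hx, this]
    · simp [hx]
  have h1 : ∫⁻ x, u x * A.indicator (fun _ => 1) x ∂productLaw p X =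
      ub (y t) * productLaw p X A := by
    rw [← hconst ub hubd]
    have := lintegral_mul_lmarginal (fun i => p.map (X i)) (D := (insert s (R s))ᶜ) hAi hu
      (hAd.mono (by intro i; simp; tauto))
    simp only [mul_comm (A.indicator _ _)] at this
    exact this.symm
  have h2 : p {ω | ∀ i ∈ R s, X i ω = y t i} =
      jointDensity p X (R s) (y t) * productLaw p X A := by
    rw [← hconst _ hFd, lintegral_jointDensity_mul hX hac hAi hAd]
    exact (lintegral_indicator_one (hXm hAm)).symm
  rw [h1, h2, ENNReal.mul_div_mul_right _ _ hνA (measure_ne_top _ _)]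

end Perfect

/-! ### Fully revealing laws: prices and states as equivalent events -/

theorem measure_inter_compl_eq_zero_of_cond_eq_one {Ω : Type} [MeasurableSpace Ω] {p : Measure Ω}
    [IsFiniteMeasure p] {s t : Set Ω} (hs : MeasurableSet s) (ht : MeasurableSet t)
    (h : p[|s] t = 1) : p (s ∩ tᶜ) = 0 := by
  have h0 : p s ≠ 0 := fun h0 => by simp [cond_eq_zero_of_meas_eq_zero h0] at h
  have := cond_isProbabilityMeasure h0
  have hc := (prob_compl_eq_zero_iff ht).2 h
  rw [cond_apply hs] at hc
  exact (mul_eq_zero.1 hc).resolve_left (ENNReal.inv_ne_zero.2 (measure_ne_top _ _))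

section Variables

variable {n : ℕ} {Θ : Fin n → Type} [∀ i, MeasurableSpace (Θ i)]

theorem measurable_coord (v : Node n) : Measurable (coord (Θ := Θ) v) := by
  cases v with
  | state i => exact (measurable_pi_apply i).comp measurable_fst
  | price => exact measurable_fst.comp measurable_snd
  | addOn => exact measurable_snd.comp measurable_snd

theorem measurableSet_priceIs (f : ℝ) : MeasurableSet (priceIs (Θ := Θ) f) :=
  (measurable_fst.comp measurable_snd) (measurableSet_singleton f)

theorem measurableSet_stateIs [∀ i, MeasurableSingletonClass (Θ i)] (θ : States Θ) :
    MeasurableSet (stateIs θ) :=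
  measurable_fst (measurableSet_singleton θ)

/-- Any statistic of the state alone factors through the first projection; the zeros are
placeholders for price and add-on. This is how quantities are shown to depend on μ only. -/
theorem map_eq_of_map_fst_eq {p p' : Measure (Outcome Θ)} (h : p.map Prod.fst = p'.map Prod.fst)
    {γ : Type} [MeasurableSpace γ] {g : Outcome Θ → γ} (hg : Measurable g)
    (hfst : ∀ ω, g ω = g (ω.1, 0, 0)) : p.map g = p'.map g := by
  have hg' : Measurable fun θ : States Θ => g (θ, 0, 0) := hg.comp (by fun_prop)
  have hcomp : g = (fun θ => g (θ, 0, 0)) ∘ Prod.fst := funext hfst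
  rw [hcomp, ← Measure.map_map hg' measurable_fst, ← Measure.map_map hg' measurable_fst, h]

variable [∀ i, Finite (Θ i)] [∀ i, MeasurableSingletonClass (Θ i)]

/-- Under a fully revealing law, the price takes finitely many values. -/
theorem IsFullyRevealing.ae_price_mem {p : Measure (Outcome Θ)} [IsProbabilityMeasure p]
    (hp : IsFullyRevealing p) : ∃ f : States Θ → ℝ, ∀ᵐ ω ∂p, ω.2.1 = f ω.1 := by
  classical
  have h1 : ∀ θ : States Θ, ∃ f : ℝ, p (stateIs θ ∩ (priceIs f)ᶜ) = 0 := by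
    intro θ
    by_cases h0 : p (stateIs θ) = 0
    -- A state of probability zero may be assigned any price.
    · exact ⟨0, measure_mono_null Set.inter_subset_left h0⟩
    · obtain ⟨f, hf⟩ := hp.1 θ h0
      exact ⟨f, measure_inter_compl_eq_zero_of_cond_eq_one (measurableSet_stateIs θ)
        (measurableSet_priceIs f) hf⟩
  choose f hf using h1
  refine ⟨f, measure_mono_null ?_ (measure_iUnion_null hf)⟩
  intro ω hω
  exact Set.mem_iUnion.2 ⟨ω.1, rfl, hω⟩

/-- Under a fully revealing law, the price `f` is equivalent to the state that it reveals. -/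
theorem IsFullyRevealing.priceIs_ae_eq {p : Measure (Outcome Θ)} [IsProbabilityMeasure p]
    (hp : IsFullyRevealing p) {f : ℝ} {θ : States Θ} (hf : p (priceIs f) ≠ 0)
    (hθ : p[|priceIs f] (stateIs θ) = 1) : priceIs f =ᵐ[p] stateIs θ := by
  have h1 := measure_inter_compl_eq_zero_of_cond_eq_one (measurableSet_priceIs f)
    (measurableSet_stateIs θ) hθ
  have h2 : p (priceIs f ∩ stateIs θ) ≠ 0 := fun h => hf <| measure_mono_null
    (Set.inter_union_compl (priceIs f) (stateIs θ)).ge (measure_union_null h h1)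
  obtain ⟨g, hg⟩ := hp.1 θ fun h => h2 (measure_mono_null Set.inter_subset_right h)
  have h3 := measure_inter_compl_eq_zero_of_cond_eq_one (measurableSet_stateIs θ)
    (measurableSet_priceIs g) hg
  -- The state `θ` carries almost surely a single price `g`, and it meets `φ = f` with positive
  -- probability.
  obtain rfl : f = g := by
    by_contra hfg
    refine h2 (measure_mono_null ?_ h3)
    rintro ω ⟨hω, hω'⟩
    exact ⟨hω', fun h => hfg ((show ω.2.1 = f from hω).symm.trans h)⟩
  exact ae_eq_set.2 ⟨h1, h3⟩

theorem measure_stateIs {μ : PMF (States Θ)} {p : Measure (Outcome Θ)}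
    (h : p.map Prod.fst = μ.toMeasure) (θ : States Θ) : p (stateIs θ) = μ θ := by
  rw [← PMF.toMeasure_apply_singleton μ θ (measurableSet_singleton θ), ← h,
    Measure.map_apply measurable_fst (measurableSet_singleton θ)]
  rfl

/-- A law under which the price and the add-on are injective functions of the state. -/
theorem exists_law_of_injective (μ : PMF (States Θ)) :
    ∃ (p : Measure (Outcome Θ)) (c : States Θ → ℝ), IsProbabilityMeasure p ∧
      p.map Prod.fst = μ.toMeasure ∧ Function.Injective c ∧ ∀ᵐ ω ∂p, ω.2 = (c ω.1, c ω.1) := by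
  obtain ⟨k, hk⟩ := exists_injective_nat (States Θ)
  let c : States Θ → ℝ := fun θ => k θ
  have hc : Measurable c := measurable_of_finite c
  have hm : Measurable fun θ : States Θ => (θ, c θ, c θ) := by fun_prop
  refine ⟨μ.toMeasure.map fun θ => (θ, c θ, c θ), c,
    Measure.isProbabilityMeasure_map hm.aemeasurable, ?_,
    Nat.cast_injective.comp hk, ?_⟩
  · rw [Measure.map_map measurable_fst hm]
    exact Measure.map_id
  · rw [ae_map_iff hm.aemeasurable (measurableSet_eq_fun (by fun_prop) (by fun_prop))]
    simp

/-! ### Laws whose price and add-on are the same injective function of the state -/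

section Injective

variable {p : Measure (Outcome Θ)} [IsProbabilityMeasure p] {c : States Θ → ℝ}
  (hc : Function.Injective c) (hpc : ∀ᵐ ω ∂p, ω.2 = (c ω.1, c ω.1))
include hpc

include hc in
theorem priceIs_ae_eq_stateIs (θ : States Θ) : priceIs (c θ) =ᵐ[p] stateIs θ := by
  filter_upwards [hpc] with ω hω
  refine propext ?_
  change ω.2.1 = c θ ↔ ω.1 = θ
  rw [hω]
  exact hc.eq_iff

theorem measure_stateIs_inter_addOnIn (θ : States Θ) (B : Set ℝ) [Decidable (c θ ∈ B)] :
    p (stateIs θ ∩ addOnIn B) = if c θ ∈ B then p (stateIs θ) else 0 := by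
  split_ifs with h
  · refine measure_congr ?_
    filter_upwards [hpc] with ω hω
    refine propext (and_iff_left_of_imp fun h' => ?_)
    change ω.2.2 ∈ B
    rwa [hω, show ω.1 = θ from h']
  · refine measure_mono_null ?_ hpc
    rintro ω ⟨h1, h2⟩ hω
    refine h ?_
    rw [← show ω.1 = θ from h1]
    have h3 : ω.2.2 ∈ B := h2
    rwa [hω] at h3

theorem cond_stateIs_addOnIn {θ : States Θ} (hθ : p (stateIs θ) ≠ 0) (B : Set ℝ)
    [Decidable (c θ ∈ B)] :
    (p[|stateIs θ]).real (addOnIn B) = if c θ ∈ B then 1 else 0 := by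
  rw [measureReal_def, cond_apply (measurableSet_stateIs θ),
    measure_stateIs_inter_addOnIn hpc θ B]
  split_ifs
  · rw [ENNReal.inv_mul_cancel hθ (measure_ne_top _ _), ENNReal.toReal_one]
  · simp

include hc in
theorem cond_priceIs_stateIs {θ : States Θ} (hθ : p (stateIs θ) ≠ 0) :
    p[|priceIs (c θ)] (stateIs θ) = 1 := by
  have h := priceIs_ae_eq_stateIs hc hpc θ
  rw [cond_apply (measurableSet_priceIs _), measure_congr h,
    measure_congr (h.inter (Filter.EventuallyEq.refl _ (stateIs θ))), Set.inter_self,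
    ENNReal.inv_mul_cancel hθ (measure_ne_top _ _)]

include hc in
theorem isFullyRevealing_of_injective : IsFullyRevealing p := by
  constructor
  · intro θ hθ
    have h := priceIs_ae_eq_stateIs hc hpc θ
    refine ⟨c θ, ?_⟩
    rw [cond_apply (measurableSet_stateIs _),
      measure_congr ((Filter.EventuallyEq.refl _ (stateIs θ)).inter h), Set.inter_self,
      ENNReal.inv_mul_cancel hθ (measure_ne_top _ _)]
  · intro f hf
    by_cases hfc : ∃ θ, c θ = f
    · obtain ⟨θ, rfl⟩ := hfc
      rw [measure_congr (priceIs_ae_eq_stateIs hc hpc θ)] at hf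
      exact ⟨θ, cond_priceIs_stateIs hc hpc hf⟩
    · refine absurd (measure_mono_null ?_ hpc) hf
      intro ω hω h
      refine hfc ⟨ω.1, ?_⟩
      rw [← show ω.2.1 = f from hω, h]

end Injective

end Variables

/-! ### Nodes of a causal model, and events that its belief does not distort -/

namespace CausalModel

variable {n : ℕ} (G : CausalModel n) (Θ : Fin n → Type)

/-- The variables of the model. -/
abbrev var (v : G.nodes) : Outcome Θ → Val Θ v := coord (v : Node n)

/-- The node `φ`. -/
abbrev priceNode : G.nodes := ⟨.price, G.price_mem⟩

/-- The node `q`. -/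
abbrev addOnNode : G.nodes := ⟨.addOn, G.addOn_mem⟩

/-- The nodes that are state variables. -/
def stateNodes : Finset G.nodes :=
  Finset.univ.filter fun v => (v : Node n) ≠ .price ∧ (v : Node n) ≠ .addOn

variable {G Θ}

theorem mem_parents {i k : G.nodes} : i ∈ G.parents k ↔ G.link i k := by
  simp [parents]

theorem acyclic_parents (i : G.nodes) :
    ¬ Relation.TransGen (fun i j => i ∈ G.parents j) i i := by
  simpa only [mem_parents] using G.acyclic i

theorem IsPerfect.parents (hG : G.IsPerfect) (i j k : G.nodes) (hij : i ≠ j)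
    (hi : i ∈ G.parents k) (hj : j ∈ G.parents k) : i ∈ G.parents j ∨ j ∈ G.parents i := by
  simp only [mem_parents] at *
  exact hG i j k hij hi hj

theorem notMem_parents_self (i : G.nodes) : i ∉ G.parents i := fun h =>
  G.acyclic i (.single (mem_parents.1 h))

theorem priceNode_ne_addOnNode : G.priceNode ≠ G.addOnNode := by simp

theorem mem_stateNodes {v : G.nodes} :
    v ∈ G.stateNodes ↔ v ≠ G.priceNode ∧ v ≠ G.addOnNode := by
  simp [stateNodes, Subtype.ext_iff]

theorem exists_state_of_mem {v : G.nodes} (hv : v ∈ G.stateNodes) :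
    ∃ i, (v : Node n) = .state i := by
  simp only [stateNodes, Finset.mem_filter, Finset.mem_univ, true_and] at hv
  rcases v with ⟨_ | _ | _, h⟩ <;> simp_all

theorem parents_subset_stateNodes {v : G.nodes} (hv : v ∈ G.stateNodes) :
    G.parents v ⊆ G.stateNodes := by
  intro i hi
  obtain ⟨k, hk⟩ := exists_state_of_mem hv
  rw [mem_stateNodes]
  constructor <;> rintro rfl
  · exact G.state_exogenous _ _ k (.inl rfl) hk (mem_parents.1 hi)
  · exact G.state_exogenous _ _ k (.inr rfl) hk (mem_parents.1 hi)

theorem univ_eq_insert : (Finset.univ : Finset G.nodes) =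
    insert G.priceNode (insert G.addOnNode G.stateNodes) := by
  ext v
  simp only [Finset.mem_univ, Finset.mem_insert, mem_stateNodes, true_iff]
  tauto

variable [∀ i, MeasurableSpace (Θ i)]

theorem measurable_var (v : G.nodes) : Measurable (G.var Θ v) := measurable_coord _

theorem var_eq_of_mem_stateNodes {v : G.nodes} (hv : v ∈ G.stateNodes) (ω : Outcome Θ) :
    G.var Θ v ω = G.var Θ v (ω.1, 0, 0) := by
  obtain ⟨i, hi⟩ := exists_state_of_mem hv
  obtain ⟨v, hm⟩ := v
  obtain rfl : v = .state i := hi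
  rfl

theorem measurableSet_singleton_of_mem_stateNodes [∀ i, MeasurableSingletonClass (Θ i)]
    {v : G.nodes} (hv : v ∈ G.stateNodes) (x : Val Θ v) : MeasurableSet {x} := by
  obtain ⟨i, hi⟩ := exists_state_of_mem hv
  obtain ⟨v, hm⟩ := v
  obtain rfl : v = .state i := hi
  exact measurableSet_singleton (α := Θ i) x

theorem measurableSet_priceEvent (f : ℝ) : MeasurableSet (G.priceEvent Θ f) :=
  (measurable_pi_apply G.priceNode : Measurable fun x : (v : G.nodes) → Val Θ v => x G.priceNode)
    (measurableSet_singleton (α := ℝ) f)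

theorem measurableSet_addOnEvent {B : Set ℝ} (hB : MeasurableSet B) :
    MeasurableSet (G.addOnEvent Θ B) :=
  (measurable_pi_apply G.addOnNode : Measurable fun x : (v : G.nodes) → Val Θ v => x G.addOnNode) hB

theorem belief_apply (p : Measure (Outcome Θ)) {Z : Set ((v : G.nodes) → Val Θ v)}
    (hZ : MeasurableSet Z) :
    G.belief p Z = ∫⁻ x, netDensity p (G.var Θ) G.parents Finset.univ x *
      Z.indicator (fun _ => 1) x ∂productLaw p (G.var Θ) := by
  rw [belief, bayesNet, withDensity_apply _ hZ, ← lintegral_indicator hZ]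
  refine lintegral_congr fun x => ?_
  by_cases hx : x ∈ Z
  · simp [hx, netDensity, condDensity]
  · simp [hx]

section AbsolutelyContinuous

variable [∀ i, Finite (Θ i)] [∀ i, MeasurableSingletonClass (Θ i)]

/-- The joint law of the variables has a density if all of them but `q` are discrete. -/
theorem map_var_absolutelyContinuous {p : Measure (Outcome Θ)} [IsProbabilityMeasure p]
    (hp : IsFullyRevealing p) :
    p.map (fun ω v => G.var Θ v ω) ≪ productLaw p (G.var Θ) := by
  have hprob := isProbabilityMeasure_marginal (p := p) (X := G.var Θ) measurable_var
  have hXm : Measurable fun ω v => G.var Θ v ω := measurable_pi_lambda _ measurable_var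
  obtain ⟨f, hf⟩ := hp.ae_price_mem
  refine Measure.AbsolutelyContinuous.mk fun N hN h0 => ?_
  rw [Measure.map_apply hXm hN]
  have key : ∀ θ : States Θ,
      p {ω | ω.1 = θ ∧ ω.2.1 = f θ ∧ (fun v => G.var Θ v ω) ∈ N} = 0 := by
    intro θ
    -- For a fixed state, `N` contains a box: points in the discrete coordinates, a slice of `N` in
    -- the coordinate `q`. The box is null, so one of its sides is null, and each side contains the
    -- event in question.
    let s : (v : Node n) → Set (Val Θ v) := fun v => match v with
      | .state i => ({θ i} : Set (Θ i))
      | .price => ({f θ} : Set ℝ)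
      | .addOn => {z : ℝ | (fun w : G.nodes => G.var Θ w (θ, f θ, z)) ∈ N}
    have hbox : Set.univ.pi (fun v : G.nodes => s v) ⊆ N := by
      intro x hx
      have hxy : x = fun w : G.nodes => G.var Θ w (θ, f θ, x G.addOnNode) := by
        funext w
        obtain ⟨w, hw⟩ := w
        have := hx ⟨w, hw⟩ trivial
        cases w with
        | state i => exact this
        | price => exact this
        | addOn => rfl
      rw [hxy]
      exact hx G.addOnNode trivial
    have h1 := measure_mono_null hbox h0
    rw [Measure.pi_pi] at h1
    obtain ⟨v, -, hv⟩ := Finset.prod_eq_zero_iff.1 h1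
    refine measure_mono_null ?_ (Measure.preimage_null_of_map_null (measurable_var v).aemeasurable hv)
    rintro ⟨θ', c, z⟩ ⟨hθ, hc, hz⟩
    obtain rfl : θ' = θ := hθ
    obtain rfl : c = f θ' := hc
    obtain ⟨v, hw⟩ := v
    cases v with
    | state i => rfl
    | price => rfl
    | addOn => exact hz
  refine measure_mono_null ?_ (measure_union_null (measure_iUnion_null key) hf)
  intro ω hω
  by_cases h : ω.2.1 = f ω.1
  · exact .inl (Set.mem_iUnion.2 ⟨ω.1, rfl, h, hω⟩)
  · exact .inr h

/-- A perfect model distorts no event about a clique. -/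
theorem belief_of_clique (hG : G.IsPerfect) {p : Measure (Outcome Θ)} [IsProbabilityMeasure p]
    (hp : IsFullyRevealing p) {C : Finset G.nodes}
    (hC : ∀ i ∈ C, ∀ j ∈ C, i ≠ j → G.link i j ∨ G.link j i)
    {Z : Set ((v : G.nodes) → Val Θ v)} (hZ : MeasurableSet Z)
    (hd : ∀ x y, (∀ i ∈ C, x i = y i) → (x ∈ Z → y ∈ Z)) :
    G.belief p Z = p {ω | (fun v => G.var Θ v ω) ∈ Z} := by
  rw [belief_apply p hZ, lintegral_netDensity_mul measurable_var (map_var_absolutelyContinuous hp)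
    acyclic_parents hG.parents (S := Finset.univ) (fun _ _ => Finset.subset_univ _)
    (Finset.subset_univ C) (by simpa only [mem_parents] using hC)
    (measurable_const.indicator hZ) (dependsOn_indicator_one hd)]
  exact lintegral_indicator_one ((measurable_pi_lambda _ measurable_var : Measurable
    fun ω v => G.var Θ v ω) hZ)

theorem belief_priceEvent (hG : G.IsPerfect) {p : Measure (Outcome Θ)} [IsProbabilityMeasure p]
    (hp : IsFullyRevealing p) (f : ℝ) : G.belief p (G.priceEvent Θ f) = p (priceIs f) :=
  belief_of_clique hG hp (C := {G.priceNode}) (by simp) (measurableSet_priceEvent f)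
    fun x y h hx => by
      have h1 := h G.priceNode (by simp)
      exact h1.symm.trans hx

theorem belief_addOnEvent (hG : G.IsPerfect) {p : Measure (Outcome Θ)} [IsProbabilityMeasure p]
    (hp : IsFullyRevealing p) {B : Set ℝ} (hB : MeasurableSet B) :
    G.belief p (G.addOnEvent Θ B) = p (addOnIn B) :=
  belief_of_clique hG hp (C := {G.addOnNode}) (by simp) (measurableSet_addOnEvent hB)
    fun x y h hx => by
      have h1 := h G.addOnNode (by simp)
      simp only [addOnEvent, Set.mem_ofPred_eq] at hx ⊢
      rwa [← h1]

theorem belief_univ (hG : G.IsPerfect) {p : Measure (Outcome Θ)} [IsProbabilityMeasure p]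
    (hp : IsFullyRevealing p) : G.belief p Set.univ = 1 := by
  rw [belief_of_clique hG hp (C := ∅) (by simp) MeasurableSet.univ (by simp)]
  simp

theorem belief_inter_of_link (hG : G.IsPerfect) {p : Measure (Outcome Θ)} [IsProbabilityMeasure p]
    (hp : IsFullyRevealing p)
    (hl : G.link G.priceNode G.addOnNode ∨ G.link G.addOnNode G.priceNode) (f : ℝ) {B : Set ℝ}
    (hB : MeasurableSet B) :
    G.belief p (G.priceEvent Θ f ∩ G.addOnEvent Θ B) = p (priceIs f ∩ addOnIn B) := by
  refine belief_of_clique hG hp (C := {G.priceNode, G.addOnNode}) ?_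
    ((measurableSet_priceEvent f).inter (measurableSet_addOnEvent hB)) ?_
  · intro i hi j hj hij
    simp only [Finset.mem_insert, Finset.mem_singleton] at hi hj
    rcases hi with rfl | rfl <;> rcases hj with rfl | rfl
    · exact absurd rfl hij
    · exact hl
    · exact hl.symm
    · exact absurd rfl hij
  · rintro x y h ⟨hx1, hx2⟩
    have h1 := h G.priceNode (by simp)
    have h2 := h G.addOnNode (by simp)
    refine ⟨h1.symm.trans hx1, ?_⟩
    simp only [addOnEvent, Set.mem_ofPred_eq] at hx2 ⊢
    rwa [← h2]

end AbsolutelyContinuous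

end CausalModel

/-! ### Price and add-on without a link: the joint belief in terms of μ -/

namespace CausalModel

variable {n : ℕ} {G : CausalModel n} {Θ : Fin n → Type} [∀ i, MeasurableSpace (Θ i)]

/-- The outcomes that agree with the state `θ` on the variables in `A`. -/
def agreeEvent (G : CausalModel n) {Θ : Fin n → Type} (A : Finset G.nodes) (θ : States Θ) :
    Set (Outcome Θ) :=
  {ω | ∀ v ∈ A, G.var Θ v ω = G.var Θ v (θ, 0, 0)}

/-- The values of the variables of the model that agree with the state `θ` on `A`. -/
def agreeValues (G : CausalModel n) {Θ : Fin n → Type} (A : Finset G.nodes) (θ : States Θ) :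
    Set ((v : G.nodes) → Val Θ v) :=
  {x | ∀ v ∈ A, x v = G.var Θ v (θ, 0, 0)}

/-- The probability, under the subjective belief over the state variables, that the parents of
`φ` are as in the state `a` and those of `q` as in the state `b`. -/
noncomputable def parentsWeight (G : CausalModel n) (p : Measure (Outcome Θ)) (a b : States Θ) :
    ℝ≥0∞ :=
  ∫⁻ x, netDensity p (G.var Θ) G.parents G.stateNodes x *
    (G.agreeValues (G.parents G.priceNode) a).indicator (fun _ => 1) x *
    (G.agreeValues (G.parents G.addOnNode) b).indicator (fun _ => 1) x ∂productLaw p (G.var Θ)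

theorem coe_subset_compl_singleton {I : Type} [Fintype I] [DecidableEq I] {A : Finset I} {s : I}
    (hs : s ∉ A) : (A : Set I) ⊆ ({s}ᶜ : Finset I) := fun i hi => by
  simp only [Finset.coe_compl, Finset.coe_singleton, Set.mem_compl_iff, Set.mem_singleton_iff]
  rintro rfl
  exact hs hi

theorem dependsOn_agreeValues {A C : Finset G.nodes} (hA : A ⊆ C) (θ : States Θ) :
    DependsOn ((G.agreeValues A θ).indicator fun _ => (1 : ℝ≥0∞)) C :=
  dependsOn_indicator_one fun x y h hx v hv => by rw [← h v (hA hv), hx v hv]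

section

variable {A : Finset G.nodes} (hA : A ⊆ G.stateNodes)
include hA

/-- Both the joint law of state variables and the product of their marginals are images of the law
of the state. -/
theorem jointDensity_congr {p p' : Measure (Outcome Θ)}
    (h : p.map Prod.fst = p'.map Prod.fst) :
    jointDensity p (G.var Θ) A = jointDensity p' (G.var Θ) A := by
  have h1 : p.map (fun ω (i : A) => G.var Θ i ω) = p'.map (fun ω (i : A) => G.var Θ i ω) :=
    map_eq_of_map_fst_eq h (measurable_pi_lambda _ fun i => measurable_var _) fun ω => by
      funext i
      exact var_eq_of_mem_stateNodes (hA i.2) ω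
  have h2 : (fun i : A => p.map (G.var Θ i)) = fun i : A => p'.map (G.var Θ i) := by
    funext i
    exact map_eq_of_map_fst_eq h (measurable_var _) (var_eq_of_mem_stateNodes (hA i.2))
  unfold jointDensity
  rw [h1, h2]

variable [∀ i, MeasurableSingletonClass (Θ i)]

theorem measurableSet_agreeEvent (θ : States Θ) : MeasurableSet (G.agreeEvent A θ) := by
  have : G.agreeEvent A θ = ⋂ v ∈ A, G.var Θ v ⁻¹' {G.var Θ v (θ, 0, 0)} := by
    ext; simp [agreeEvent]
  rw [this]
  exact Finset.measurableSet_biInter _ fun v hv =>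
    measurable_var v (measurableSet_singleton_of_mem_stateNodes (hA hv) _)

theorem measurable_agreeValues (θ : States Θ) :
    Measurable ((G.agreeValues A θ).indicator fun _ => (1 : ℝ≥0∞)) := by
  refine measurable_const.indicator ?_
  have : G.agreeValues A θ =
      ⋂ v ∈ A, (fun x : (v : G.nodes) → Val Θ v => x v) ⁻¹' {G.var Θ v (θ, 0, 0)} := by
    ext; simp [agreeValues]
  rw [this]
  exact Finset.measurableSet_biInter _ fun v hv =>
    measurable_pi_apply v (measurableSet_singleton_of_mem_stateNodes (hA hv) _)

theorem measure_agreeEvent_congr {p p' : Measure (Outcome Θ)}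
    (h : p.map Prod.fst = p'.map Prod.fst) (θ : States Θ) :
    p (G.agreeEvent A θ) = p' (G.agreeEvent A θ) := by
  have hpre : G.agreeEvent A θ = Prod.fst ⁻¹' {t : States Θ | (t, 0, 0) ∈ G.agreeEvent A θ} := by
    ext ω
    exact forall₂_congr fun v hv => by rw [var_eq_of_mem_stateNodes (hA hv)]
  have hm : MeasurableSet {t : States Θ | (t, 0, 0) ∈ G.agreeEvent A θ} :=
    (by fun_prop : Measurable fun t : States Θ => (t, (0 : ℝ), (0 : ℝ)))
      (measurableSet_agreeEvent hA θ)
  rw [hpre, ← Measure.map_apply measurable_fst hm, ← Measure.map_apply measurable_fst hm, h]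

end

variable [∀ i, MeasurableSingletonClass (Θ i)]

section Unlinked

variable (hφ : G.parents G.priceNode ⊆ G.stateNodes) (hq : G.parents G.addOnNode ⊆ G.stateNodes)
include hφ hq

/-- Makes β independent of `p`: the integrand involves only state variables, so price and add-on
integrate out, and the remaining densities and marginals are determined by the law of the state. -/
theorem parentsWeight_congr {p p' : Measure (Outcome Θ)} [IsProbabilityMeasure p]
    [IsProbabilityMeasure p'] (h : p.map Prod.fst = p'.map Prod.fst) (a b : States Θ) :
    G.parentsWeight p a b = G.parentsWeight p' a b := by
  have h1 := isProbabilityMeasure_marginal (p := p) (X := G.var Θ) measurable_var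
  have h2 := isProbabilityMeasure_marginal (p := p') (X := G.var Θ) measurable_var
  have hS : ∀ i ∈ G.stateNodes, G.parents i ⊆ G.stateNodes := fun i => parents_subset_stateNodes
  have hnet : netDensity p (G.var Θ) G.parents G.stateNodes =
      netDensity p' (G.var Θ) G.parents G.stateNodes := by
    funext x
    refine Finset.prod_congr rfl fun i hi => ?_
    rw [condDensity, condDensity, jointDensity_congr (hS i hi) h,
      jointDensity_congr (Finset.insert_subset hi (hS i hi)) h]
  have hmarg : (fun i : G.stateNodes => p.map (G.var Θ i)) = fun i : G.stateNodes => p'.map (G.var Θ i) := by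
    funext i
    exact map_eq_of_map_fst_eq h (measurable_var _) (var_eq_of_mem_stateNodes i.2)
  have hm := ((measurable_netDensity p' (G.var Θ) G.parents G.stateNodes).mul
    (measurable_agreeValues hφ a)).mul (measurable_agreeValues hq b)
  have hd := ((dependsOn_netDensity p' (G.var Θ) G.parents hS).mul
    (dependsOn_agreeValues hφ a)).mul (dependsOn_agreeValues hq b)
  unfold parentsWeight
  rw [hnet]
  -- The base point only fills the coordinates outside the state nodes and is arbitrary.
  have e1 := lintegral_eq_lmarginal_of_dependsOn (fun i => p.map (G.var Θ i)) hd hm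
    fun v => G.var Θ v (a, 0, 0)
  have e2 := lintegral_eq_lmarginal_of_dependsOn (fun i => p'.map (G.var Θ i)) hd hm
    fun v => G.var Θ v (a, 0, 0)
  refine e1.trans (Eq.trans ?_ e2.symm)
  unfold lmarginal
  rw [hmarg]

variable [∀ i, Finite (Θ i)]

/-- The weight is at most the total mass of the network on the state nodes, which is one by the
clique lemma for the empty clique. -/
theorem parentsWeight_ne_top (hG : G.IsPerfect) {p : Measure (Outcome Θ)} [IsProbabilityMeasure p]
    (hp : IsFullyRevealing p) (a b : States Θ) : G.parentsWeight p a b ≠ ∞ := by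
  have hS : ∀ i ∈ G.stateNodes, G.parents i ⊆ G.stateNodes := fun i => parents_subset_stateNodes
  have h := lintegral_netDensity_mul measurable_var (map_var_absolutelyContinuous (G := G) hp)
    acyclic_parents hG.parents hS (Finset.empty_subset _) (by simp) (h := fun _ => 1)
    measurable_const fun _ _ _ => rfl
  refine ne_top_of_le_ne_top (b := 1) ENNReal.one_ne_top ?_
  calc _ ≤ _ := lintegral_mono fun x => ?_
    _ = _ := h
    _ = 1 := by simp
  have hle : ∀ (A : Finset G.nodes) (θ : States Θ),
      (G.agreeValues A θ).indicator (fun _ => (1 : ℝ≥0∞)) x ≤ 1 := fun A θ =>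
    Set.indicator_le_self' (fun _ _ => zero_le) x
  calc _ ≤ netDensity p (G.var Θ) G.parents G.stateNodes x * 1 * 1 := by
        gcongr <;> exact hle _ _
    _ = _ := by rw [mul_one]

/-- The joint subjective belief about price and add-on if they are not linked. -/
theorem belief_inter_of_not_link [Fintype (States Θ)] {p : Measure (Outcome Θ)}
    [IsProbabilityMeasure p] (hp : IsFullyRevealing p) {f : ℝ} {a : States Θ}
    (ha : p (priceIs f ∩ (stateIs a)ᶜ) = 0) {B : Set ℝ} (hB : MeasurableSet B) :
    G.belief p (G.priceEvent Θ f ∩ G.addOnEvent Θ B) =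
      p (priceIs f) * ((∑ b, p (stateIs b ∩ addOnIn B) *
        (G.parentsWeight p a b / p (G.agreeEvent (G.parents G.addOnNode) b))) /
          p (G.agreeEvent (G.parents G.priceNode) a)) := by
  have hac := map_var_absolutelyContinuous (G := G) hp
  have hS : ∀ i ∈ G.stateNodes, G.parents i ⊆ G.stateNodes := fun i => parents_subset_stateNodes
  have hqS : G.addOnNode ∉ G.stateNodes := by simp [mem_stateNodes]
  have hφS : G.priceNode ∉ G.stateNodes := by simp [mem_stateNodes]
  have hne := priceNode_ne_addOnNode (G := G)
  have hW := measurable_netDensity p (G.var Θ) G.parents G.stateNodes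
  have hWd := dependsOn_netDensity p (G.var Θ) G.parents hS
  have hBm : Measurable ((G.addOnEvent Θ B).indicator fun _ => (1 : ℝ≥0∞)) :=
    measurable_const.indicator (measurableSet_addOnEvent hB)
  have hkm := (measurable_condDensity p (G.var Θ) G.parents G.addOnNode).mul hBm
  have hkd : DependsOn (fun x => condDensity p (G.var Θ) G.parents G.addOnNode x *
      (G.addOnEvent Θ B).indicator (fun _ => (1 : ℝ≥0∞)) x)
      (insert G.addOnNode (G.parents G.addOnNode) : Finset G.nodes) :=
    (dependsOn_condDensity _ _ _ _).mul <| dependsOn_indicator_one fun x y h hx => by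
      have h1 := h G.addOnNode (by simp)
      simp only [addOnEvent, Set.mem_ofPred_eq] at hx ⊢
      rwa [← h1]
  have hud : DependsOn (fun x => netDensity p (G.var Θ) G.parents G.stateNodes x *
      (condDensity p (G.var Θ) G.parents G.addOnNode x *
      (G.addOnEvent Θ B).indicator (fun _ => (1 : ℝ≥0∞)) x)) ({G.priceNode}ᶜ : Finset G.nodes) := by
    refine (hWd.mono ?_).mul (hkd.mono ?_)
    · exact coe_subset_compl_singleton hφS
    · refine coe_subset_compl_singleton ?_
      simp only [Finset.mem_insert, not_or]
      exact ⟨hne, fun h => hφS (hq h)⟩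
  have hy : ∀ {s : G.nodes}, G.parents s ⊆ G.stateNodes → ∀ ω, ∀ i ∈ G.parents s,
      G.var Θ i ω = G.var Θ i (ω.1, 0, 0) := fun hs ω i hi =>
    var_eq_of_mem_stateNodes (hs hi) ω
  have hsing : ∀ {s : G.nodes}, G.parents s ⊆ G.stateNodes → ∀ t : States Θ, ∀ i ∈ G.parents s,
      MeasurableSet {G.var Θ i (t, 0, 0)} := fun hs t i hi =>
    measurableSet_singleton_of_mem_stateNodes (hs hi) _
  -- Neither `φ` nor `q` is a parent of the other, so their factors come off one after the other:
  -- first `φ`, with everything else as weight, then `q`.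
  have hpriceStep := lintegral_mul_condDensity_of_discrete (R := G.parents) measurable_var hac
    measurable_fst (fun t v => G.var Θ v (t, 0, 0)) (s := G.priceNode) (hy hφ) (hsing hφ)
    (hW.mul hkm) hud (B := ({f} : Set ℝ)) (measurableSet_singleton (α := ℝ) f)
  have haddOnStep := lintegral_mul_condDensity_of_discrete (R := G.parents) measurable_var hac
    measurable_fst (fun t v => G.var Θ v (t, 0, 0)) (s := G.addOnNode) (hy hq) (hsing hq)
    (hW.mul (measurable_agreeValues hφ a)) ((hWd.mul (dependsOn_agreeValues hφ a)).mono
      (coe_subset_compl_singleton hqS)) hB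
  -- The price `f` reveals `a`, so the sum over states in the price step has a single term.
  have hstate : ∀ t : States Θ, t ≠ a →
      p (Prod.fst ⁻¹' {t} ∩ G.var Θ G.priceNode ⁻¹' ({f} : Set ℝ)) = 0 := fun t ht =>
    measure_mono_null (by
      rintro ω ⟨h1, h2⟩
      refine ⟨h2, fun h3 => ht ?_⟩
      exact (Set.mem_singleton_iff.1 h1).symm.trans h3) ha
  have hstate' : p (Prod.fst ⁻¹' {a} ∩ G.var Θ G.priceNode ⁻¹' ({f} : Set ℝ)) = p (priceIs f) := by
    have := measure_inter_add_sdiff (μ := p) (priceIs f) (measurableSet_stateIs a)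
    rw [Set.sdiff_eq, ha, add_zero, Set.inter_comm] at this
    exact this
  rw [Finset.sum_eq_single a (fun t _ ht => by rw [hstate t ht, zero_mul]) (by simp),
    hstate'] at hpriceStep
  rw [belief_apply p ((measurableSet_priceEvent f).inter (measurableSet_addOnEvent hB)),
    univ_eq_insert]
  refine Eq.trans (lintegral_congr fun x => ?_) (hpriceStep.trans ?_)
  · rw [netDensity_insert _ _ _ (by simp [mem_stateNodes, hne]), netDensity_insert _ _ _ hqS]
    change _ = netDensity p (G.var Θ) G.parents G.stateNodes x *
      (condDensity p (G.var Θ) G.parents G.addOnNode x *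
        (G.addOnEvent Θ B).indicator (fun _ => (1 : ℝ≥0∞)) x) *
      (condDensity p (G.var Θ) G.parents G.priceNode x *
        (G.priceEvent Θ f).indicator (fun _ => (1 : ℝ≥0∞)) x)
    by_cases h1 : x ∈ G.priceEvent Θ f <;> by_cases h2 : x ∈ G.addOnEvent Θ B
    · simp only [Set.indicator_of_mem h1, Set.indicator_of_mem h2,
        Set.indicator_of_mem (Set.mem_inter h1 h2)]
      ring
    all_goals simp [h1, h2]
  · congr 2
    refine Eq.trans (lintegral_congr fun x => ?_) (haddOnStep.trans rfl)
    change netDensity p (G.var Θ) G.parents G.stateNodes x *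
      (condDensity p (G.var Θ) G.parents G.addOnNode x *
        (G.addOnEvent Θ B).indicator (fun _ => (1 : ℝ≥0∞)) x) *
      (G.agreeValues (G.parents G.priceNode) a).indicator (fun _ => (1 : ℝ≥0∞)) x =
      netDensity p (G.var Θ) G.parents G.stateNodes x *
      (G.agreeValues (G.parents G.priceNode) a).indicator (fun _ => (1 : ℝ≥0∞)) x *
      (condDensity p (G.var Θ) G.parents G.addOnNode x *
        (G.addOnEvent Θ B).indicator (fun _ => (1 : ℝ≥0∞)) x)
    ring

end Unlinked

end CausalModel

/-! ### Existence of a representing matrix -/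

namespace CausalModel

variable {n : ℕ} {G : CausalModel n} {Θ : Fin n → Type} [∀ i, Finite (Θ i)]
  [∀ i, MeasurableSpace (Θ i)] [∀ i, MeasurableSingletonClass (Θ i)] {μ : PMF (States Θ)}

theorem stateNodes_of_not_link {s : G.nodes} (hφ : ¬ G.link G.priceNode s)
    (hq : ¬ G.link G.addOnNode s) : G.parents s ⊆ G.stateNodes := by
  intro i hi
  have hi' := mem_parents.1 hi
  rw [mem_stateNodes]
  constructor <;> rintro rfl
  · exact hφ hi'
  · exact hq hi'

/-- Price and add-on form a clique, so their joint law is correct; as the price is equivalent to the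
state, β is the identity. -/
theorem exists_represents_of_link (hG : G.IsPerfect)
    (hl : G.link G.priceNode G.addOnNode ∨ G.link G.addOnNode G.priceNode) :
    ∃ β : μ.support → μ.support → ℝ, (∀ θ θ', 0 ≤ β θ θ') ∧ Represents μ G β := by
  classical
  refine ⟨fun θ θ' => if θ = θ' then 1 else 0, fun θ θ' => by positivity, ?_⟩
  intro p _ hpμ hp f hf θ hθ B hB
  have hae := hp.priceIs_ae_eq hf hθ
  simp only [ite_mul, one_mul, zero_mul, Finset.sum_ite_eq, Finset.mem_univ, if_true]
  rw [measureReal_def, measureReal_def, cond_apply (measurableSet_priceEvent f),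
    cond_apply (measurableSet_stateIs _), belief_priceEvent hG hp, belief_inter_of_link hG hp hl f hB,
    measure_congr hae, measure_congr (hae.inter (Filter.EventuallyEq.refl _ (addOnIn B)))]

theorem exists_represents_of_not_link (hG : G.IsPerfect)
    (hφ : G.parents G.priceNode ⊆ G.stateNodes) (hq : G.parents G.addOnNode ⊆ G.stateNodes) :
    ∃ β : μ.support → μ.support → ℝ, (∀ θ θ', 0 ≤ β θ θ') ∧ Represents μ G β := by
  classical
  have : Fintype (States Θ) := Fintype.ofFinite _
  obtain ⟨p₀, c, hp₀, hp₀μ, hc, hpc⟩ := exists_law_of_injective μ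
  -- The law `p₀` serves only as a representative with marginal μ; every quantity taken from it
  -- depends on μ alone.
  refine ⟨fun a b => (G.parentsWeight p₀ a b / p₀ (G.agreeEvent (G.parents G.addOnNode) b) * μ b /
    p₀ (G.agreeEvent (G.parents G.priceNode) a)).toReal, fun _ _ => ENNReal.toReal_nonneg, ?_⟩
  intro p _ hpμ hp f hf a ha B hB
  have hμ := measure_stateIs hpμ
  have hpp : p₀.map Prod.fst = p.map Prod.fst := hp₀μ.trans hpμ.symm
  have hae := hp.priceIs_ae_eq hf ha
  have hagree : ∀ A ⊆ G.stateNodes, ∀ b : μ.support, p (G.agreeEvent A b) ≠ 0 := fun A hA b h => by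
    refine (PMF.mem_support_iff _ _).1 b.2 ?_
    rw [← hμ]
    refine measure_mono_null (fun ω hω => ?_) h
    intro v hv
    rw [var_eq_of_mem_stateNodes (hA hv), show ω.1 = b from hω]
  have hsum : ∑ b, p (stateIs b ∩ addOnIn B) *
      (G.parentsWeight p a b / p (G.agreeEvent (G.parents G.addOnNode) b)) =
      ∑ b : μ.support, p (stateIs b ∩ addOnIn B) *
      (G.parentsWeight p a b / p (G.agreeEvent (G.parents G.addOnNode) b)) := by
    rw [← Finset.sum_subtype (Finset.univ.filter (· ∈ μ.support)) (by simp)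
      fun b => p (stateIs b ∩ addOnIn B) *
        (G.parentsWeight p a b / p (G.agreeEvent (G.parents G.addOnNode) b))]
    refine (Finset.sum_subset (Finset.subset_univ _) fun b _ hb => ?_).symm
    have hb0 : p (stateIs b) = 0 := by
      rw [hμ]
      simpa [PMF.mem_support_iff] using hb
    rw [measure_mono_null Set.inter_subset_left hb0, zero_mul]
  rw [measureReal_def, cond_apply (measurableSet_priceEvent f), belief_priceEvent hG hp,
    belief_inter_of_not_link hφ hq hp (ae_eq_set.1 hae).1 hB, ← mul_assoc,
    ENNReal.inv_mul_cancel hf (measure_ne_top _ _), one_mul, hsum, div_eq_mul_inv, Finset.sum_mul,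
    ENNReal.toReal_sum]
  · refine Finset.sum_congr rfl fun b _ => ?_
    rw [measureReal_def, cond_apply (measurableSet_stateIs _), ← ENNReal.toReal_mul,
      parentsWeight_congr hφ hq hpp, measure_agreeEvent_congr hq hpp,
      measure_agreeEvent_congr hφ hpp, hμ]
    congr 1
    -- The factor `μ b` in β is what turns the joint probability of state and add-on into a
    -- conditional one.
    have hb : μ b * (μ b)⁻¹ = 1 :=
      ENNReal.mul_inv_cancel ((PMF.mem_support_iff _ _).1 b.2) (PMF.apply_ne_top _ _)
    calc _ = p (stateIs b ∩ addOnIn B) *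
          (G.parentsWeight p a b / p (G.agreeEvent (G.parents G.addOnNode) b)) *
          (p (G.agreeEvent (G.parents G.priceNode) a))⁻¹ * 1 := by rw [mul_one]
      _ = _ := by
        rw [← hb]
        simp only [div_eq_mul_inv]
        ring
  · intro b _
    refine ENNReal.mul_ne_top (ENNReal.mul_ne_top (measure_ne_top _ _) (ENNReal.div_ne_top ?_ ?_))
      (ENNReal.inv_ne_top.2 (hagree _ hφ a))
    · exact parentsWeight_ne_top hφ hq hG hp _ _
    · exact hagree _ hq b

/-- Only nonnegativity is needed here: the row sums follow from the representation itself. -/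
theorem exists_represents (hG : G.IsPerfect) (μ : PMF (States Θ)) :
    ∃ β : μ.support → μ.support → ℝ, (∀ θ θ', 0 ≤ β θ θ') ∧ Represents μ G β := by
  by_cases hl : G.link G.priceNode G.addOnNode ∨ G.link G.addOnNode G.priceNode
  · exact exists_represents_of_link hG hl
  · push Not at hl
    have h := fun i : G.nodes => mem_parents.not.1 (notMem_parents_self i)
    exact exists_represents_of_not_link hG (stateNodes_of_not_link (h _) hl.2)
      (stateNodes_of_not_link hl.1 (h _))

/-! ### Uniqueness, row sums and invariance from one injective law -/

section Injective

variable {p : Measure (Outcome Θ)} [IsProbabilityMeasure p] {c : States Θ → ℝ}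
  (hG : G.IsPerfect) (hpμ : p.map Prod.fst = μ.toMeasure)
  (hc : Function.Injective c) (hpc : ∀ᵐ ω ∂p, ω.2 = (c ω.1, c ω.1))
include hpμ hc hpc

theorem measure_priceIs_of_injective (θ : States Θ) : p (priceIs (c θ)) = μ θ := by
  rw [measure_congr (priceIs_ae_eq_stateIs hc hpc θ), measure_stateIs hpμ]

/-- A representing matrix computes subjective beliefs under a law with injective price and
add-on by summing over the states with the given add-on. -/
theorem cond_belief_eq_sum {β : μ.support → μ.support → ℝ} (hβ : Represents μ G β)
    (θ : μ.support) {B : Set ℝ} (hB : MeasurableSet B) [DecidablePred (· ∈ B)] :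
    ((G.belief p)[|G.priceEvent Θ (c θ)]).real (G.addOnEvent Θ B) =
      ∑ θ' : μ.support, if c θ' ∈ B then β θ θ' else 0 := by
  have h0 : ∀ θ : μ.support, p (stateIs (θ : States Θ)) ≠ 0 := fun θ => by
    rw [measure_stateIs hpμ]
    exact (PMF.mem_support_iff _ _).1 θ.2
  have hp := isFullyRevealing_of_injective hc hpc
  rw [hβ p inferInstance hpμ hp (c θ)
    (by rw [measure_congr (priceIs_ae_eq_stateIs hc hpc _)]; exact h0 θ) θ
    (cond_priceIs_stateIs hc hpc (h0 θ)) B hB]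
  exact Finset.sum_congr rfl fun θ' _ => by
    rw [cond_stateIs_addOnIn hpc (h0 θ'), mul_ite, mul_one, mul_zero]

/-- The left side does not mention β, so every entry is determined; this is uniqueness. -/
theorem cond_belief_singleton {β : μ.support → μ.support → ℝ} (hβ : Represents μ G β)
    (θ θ' : μ.support) :
    ((G.belief p)[|G.priceEvent Θ (c θ)]).real (G.addOnEvent Θ {c θ'}) = β θ θ' := by
  classical
  rw [cond_belief_eq_sum hpμ hc hpc hβ θ (measurableSet_singleton _)]
  simp [hc.eq_iff, Subtype.coe_inj]

include hG

/-- Take the sure event for the add-on; the conditional belief has mass one because the price event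
keeps its positive probability. -/
theorem sum_eq_one_of_represents {β : μ.support → μ.support → ℝ} (hβ : Represents μ G β)
    (θ : μ.support) : ∑ θ', β θ θ' = 1 := by
  classical
  have hp := isFullyRevealing_of_injective hc hpc
  have h := cond_belief_eq_sum hpμ hc hpc hβ θ MeasurableSet.univ
  simp only [Set.mem_univ, if_true] at h
  have h1 : G.belief p (G.priceEvent Θ (c θ)) = μ θ := by
    rw [belief_priceEvent hG hp, measure_priceIs_of_injective hpμ hc hpc]
  rw [← h, measureReal_def, cond_apply (measurableSet_priceEvent _),
    show G.addOnEvent Θ Set.univ = Set.univ from Set.eq_univ_of_forall fun x =>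
      Set.mem_univ (α := ℝ) (x G.addOnNode), Set.inter_univ, h1,
    ENNReal.inv_mul_cancel ((PMF.mem_support_iff _ _).1 θ.2) (PMF.apply_ne_top _ _),
    ENNReal.toReal_one]

/-- The law of total probability under `p_G`: the terms are beliefs in disjoint price events joined
with one add-on, and both marginals of the belief are correct. -/
theorem isInvariantDistribution_of_represents {β : μ.support → μ.support → ℝ}
    (hβ : Represents μ G β) : IsInvariantDistribution μ β := by
  classical
  intro b
  have hp := isFullyRevealing_of_injective hc hpc
  have hfin : IsFiniteMeasure (G.belief p) := ⟨by rw [belief_univ hG hp]; exact ENNReal.one_lt_top⟩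
  have hprice : ∀ θ : States Θ, G.belief p (G.priceEvent Θ (c θ)) = μ θ := fun θ => by
    rw [belief_priceEvent hG hp, measure_priceIs_of_injective hpμ hc hpc]
  have hq : MeasurableSet (G.addOnEvent Θ {c b}) := measurableSet_addOnEvent (measurableSet_singleton _)
  have hterm : ∀ a : μ.support, (μ a).toReal * β a b =
      (G.belief p (G.priceEvent Θ (c a) ∩ G.addOnEvent Θ {c b})).toReal := fun a => by
    rw [← cond_belief_singleton hpμ hc hpc hβ, measureReal_def, ← ENNReal.toReal_mul,
      cond_apply (measurableSet_priceEvent _), hprice, ← mul_assoc,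
      ENNReal.mul_inv_cancel ((PMF.mem_support_iff _ _).1 a.2) (PMF.apply_ne_top _ _), one_mul]
  -- No subjective mass sits on other prices: this event concerns the price alone, a one-element
  -- clique.
  have hU : G.belief p (⋃ a : μ.support, G.priceEvent Θ (c a))ᶜ = 0 := by
    rw [belief_of_clique hG hp (C := {G.priceNode}) (by simp)
      (MeasurableSet.iUnion fun a => measurableSet_priceEvent _).compl]
    · have hsupp : p (Prod.fst ⁻¹' μ.supportᶜ) = 0 := by
        rw [← Measure.map_apply measurable_fst (Set.toFinite _).measurableSet, hpμ,
          PMF.toMeasure_apply_eq_zero_iff _ (Set.toFinite _).measurableSet]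
        exact disjoint_compl_right
      refine measure_mono_null ?_ (measure_union_null hsupp hpc)
      intro ω hω
      by_contra h
      simp only [Set.mem_union, not_or] at h
      have h1 : ω.1 ∈ μ.support := not_not.1 h.1
      have h2 : ω.2 = (c ω.1, c ω.1) := not_not.1 h.2
      refine hω (Set.mem_iUnion.2 ⟨⟨ω.1, h1⟩, ?_⟩)
      exact congrArg Prod.fst h2
    · intro x y h hx hy
      refine hx ?_
      obtain ⟨a, ha⟩ := Set.mem_iUnion.1 hy
      exact Set.mem_iUnion.2 ⟨a, (h G.priceNode (by simp)).trans ha⟩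
  calc ∑ a : μ.support, (μ a).toReal * β a b
      = (∑ a : μ.support, G.belief p (G.priceEvent Θ (c a) ∩ G.addOnEvent Θ {c b})).toReal := by
        rw [ENNReal.toReal_sum fun _ _ => measure_ne_top _ _]
        exact Finset.sum_congr rfl fun a _ => hterm a
    _ = (G.belief p (⋃ a : μ.support, G.priceEvent Θ (c a) ∩ G.addOnEvent Θ {c b})).toReal := by
        rw [measure_iUnion _ fun a => (measurableSet_priceEvent _).inter hq, tsum_fintype]
        intro a a' haa
        refine Set.disjoint_left.2 fun x hx hx' => haa (Subtype.ext (hc ?_))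
        exact hx.1.symm.trans hx'.1
    _ = (G.belief p (G.addOnEvent Θ {c b})).toReal := by
        rw [← Set.iUnion_inter, Set.inter_comm, measure_inter_conull hU]
    _ = (μ b).toReal := by
        rw [belief_addOnEvent hG hp (measurableSet_singleton _), ← measure_stateIs hpμ]
        congr 1
        refine measure_congr ?_
        filter_upwards [hpc] with ω hω
        refine propext ?_
        change ω.2.2 = c b ↔ ω.1 = b
        rw [hω]
        exact hc.eq_iff

end Injective

end CausalModel

theorem lemma1 {n : ℕ} {Θ : Fin n → Type} [∀ i, Finite (Θ i)] [∀ i, MeasurableSpace (Θ i)]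
    [∀ i, MeasurableSingletonClass (Θ i)] (μ : PMF (States Θ)) (G : CausalModel n)
    (hG : G.IsPerfect) :
    (∃! β : μ.support → μ.support → ℝ, IsTransitionMatrix β ∧ Represents μ G β) ∧
    ∀ β : μ.support → μ.support → ℝ, IsTransitionMatrix β → Represents μ G β →
      IsInvariantDistribution μ β := by
  obtain ⟨p, c, _, hpμ, hc, hpc⟩ := exists_law_of_injective μ
  obtain ⟨β, hβ0, hβ⟩ := CausalModel.exists_represents hG μ
  refine ⟨⟨β, ⟨⟨hβ0, CausalModel.sum_eq_one_of_represents hG hpμ hc hpc hβ⟩, hβ⟩, ?_⟩,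
    fun β _ hβ => CausalModel.isInvariantDistribution_of_represents hG hpμ hc hpc hβ⟩
  rintro β' ⟨-, hβ'⟩
  funext θ θ'
  rw [← CausalModel.cond_belief_singleton hpμ hc hpc hβ,
    ← CausalModel.cond_belief_singleton hpμ hc hpc hβ']
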